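/- Let $\mathcal S\subset\mathbb R^{n+1}$ be a smooth embedded hypersurface, $p\in\mathcal S$, and let $\boldsymbol N$ be a smooth unit normal vector field of $\mathcal S$ around $p$. Let $\boldsymbol e_1,\dots,\boldsymbol e_n$ be an orthonormal basis of $T_p\mathcal S$ consisting of principal directions, i.e. of eigenvectors of the Weingarten map $\hat{\boldsymbol S}(\boldsymbol x)=-D_{\boldsymbol x}\boldsymbol N$ at $p$, with principal curvatures $\kappa_1,\dots,\kappa_n$, so that $\hat{\boldsymbol S}(\boldsymbol e_\mu)=\kappa_\mu\boldsymbol e_\mu$, and let $H=\sum_{\mu=1}^n\kappa_\mu$. For $\varepsilon>0$ let $V_p^+(\varepsilon)$ be the connected component of $B^{(n+1)}_p(\varepsilon)\setminus\mathcal S$ into which $\boldsymbol N(p)$ points, where $B^{(n+1)}_p(\varepsilon)\subset\mathbb R^{n+1}$ is the ball of radius $\varepsilon$ centered at $p$, and for a domain $D$ of finite positive volume let $$C(D)=\int_D(\boldsymbol X-\boldsymbol s(D))\otimes(\boldsymbol X-\boldsymbol s(D))^T\,\mathrm{dVol},\qquad \boldsymbol s(D)=\frac1{\mathrm{Vol}(D)}\int_D\boldsymbol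 X\,\mathrm{dVol},$$ be its (unnormalized) covariance matrix and its barycenter. Let $V_m(\varepsilon)$ be the volume of a ball of radius $\varepsilon$ in $\mathbb R^m$. Then the $n+1$ eigenvalues (with multiplicity) of $C(V_p^+(\varepsilon))$ can be labelled $\lambda_1(\varepsilon),\dots,\lambda_{n+1}(\varepsilon)$ in such a way that, as $\varepsilon\to0^+$, $$\lambda_\mu(\varepsilon)=V_{n+1}(\varepsilon)\frac{\varepsilon^2}{2(n+3)}-V_n(\varepsilon)\frac{\varepsilon^4}{2(n+2)(n+4)}(2\kappa_\mu+H)+\mathcal O(\varepsilon^{n+5}),\qquad \mu=1,\dots,n,$$ $$\lambda_{n+1}(\varepsilon)=V_{n+1}(\varepsilon)\frac{\varepsilon^2}{2(n+3)}-2\frac{V_n(\varepsilon)^2}{V_{n+1}(\varepsilon)}\frac{\varepsilon^4}{(n+2)^2}\left(1+\frac{V_n(\varepsilon)}{V_{n+1}(\varepsilon)}\frac{\varepsilon^2}{n+2}H\right)+\mathcal O(\varepsilon^{n+5}),$$ and, if moreover $\kappa_1,\dots,\kappa_n$ are pairwise distinct, the corresponding eigenvectors converge linearly to the principal directions and quadratically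 to the normal: for every choice of unit eigenvectors $\boldsymbol v_i(\varepsilon)$ of $C(V_p^+(\varepsilon))$ for the eigenvalues $\lambda_i(\varepsilon)$, defined for all small $\varepsilon>0$, $$\min\|\boldsymbol v_\mu(\varepsilon)\mp\boldsymbol e_\mu\|=\mathcal O(\varepsilon)\quad(\mu=1,\dots,n),\qquad \min\|\boldsymbol v_{n+1}(\varepsilon)\mp\boldsymbol N(p)\|=\mathcal O(\varepsilon^2),$$ where each minimum is over the two signs. -/

import Mathlib

open MeasureTheory Filter Topology Asymptotics
open scoped ContDiff

noncomputable section

/-- A smooth (embedded) hypersurface of `ℝⁿ⁺¹`: a set that near each of its points is the zero set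
of a smooth real function without critical points. -/
def IsSmoothHypersurface {n : ℕ} (S : Set (EuclideanSpace ℝ (Fin (n + 1)))) : Prop :=
  ∀ p ∈ S, ∃ (U : Set (EuclideanSpace ℝ (Fin (n + 1)))) (f : EuclideanSpace ℝ (Fin (n + 1)) → ℝ),
    IsOpen U ∧ p ∈ U ∧ ContDiffOn ℝ ∞ f U ∧ (∀ x ∈ U, fderiv ℝ f x ≠ 0) ∧
      S ∩ U = {x ∈ U | f x = 0}

/-- The tangent space of `S` at `q`: the velocities at `q` of curves lying in `S`. -/
def tangentVectorsAt {n : ℕ} (S : Set (EuclideanSpace ℝ (Fin (n + 1))))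
    (q : EuclideanSpace ℝ (Fin (n + 1))) : Set (EuclideanSpace ℝ (Fin (n + 1))) :=
  {v | ∃ γ : ℝ → EuclideanSpace ℝ (Fin (n + 1)),
    γ 0 = q ∧ (∀ᶠ t in 𝓝 (0 : ℝ), γ t ∈ S) ∧ HasDerivAt γ v 0}

/-- `N` is a smooth unit normal vector field of `S` around `p`. As usual, a vector field on a
neighbourhood of `p` in `S` is called smooth if it is the restriction of a smooth map defined on a
neighbourhood of `p` in the ambient space; `N` is such an extension, constrained only on `S`. -/
def IsUnitNormalFieldAround {n : ℕ} (S : Set (EuclideanSpace ℝ (Fin (n + 1))))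
    (N : EuclideanSpace ℝ (Fin (n + 1)) → EuclideanSpace ℝ (Fin (n + 1)))
    (p : EuclideanSpace ℝ (Fin (n + 1))) : Prop :=
  ∃ U : Set (EuclideanSpace ℝ (Fin (n + 1))), IsOpen U ∧ p ∈ U ∧ ContDiffOn ℝ ∞ N U ∧
    ∀ q ∈ S ∩ U, ‖N q‖ = 1 ∧ ∀ v ∈ tangentVectorsAt S q, inner ℝ v (N q) = 0

/-- The Weingarten map `v ↦ -D_v N` at `p`. On tangent vectors it depends only on the values
of `N` on the hypersurface. -/
def weingartenMap {n : ℕ} (N : EuclideanSpace ℝ (Fin (n + 1)) → EuclideanSpace ℝ (Fin (n + 1)))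
    (p v : EuclideanSpace ℝ (Fin (n + 1))) : EuclideanSpace ℝ (Fin (n + 1)) :=
  -(fderiv ℝ N p v)

/-- `e` is an orthonormal basis of the tangent space of `S` at `p` that consists of principal
directions, with principal curvatures `κ` with respect to the unit normal field `N`. (The tangent
space has dimension `n`, so `n` orthonormal tangent vectors form a basis.) -/
structure IsPrincipalBasis {n : ℕ} (S : Set (EuclideanSpace ℝ (Fin (n + 1))))
    (N : EuclideanSpace ℝ (Fin (n + 1)) → EuclideanSpace ℝ (Fin (n + 1)))
    (p : EuclideanSpace ℝ (Fin (n + 1))) (κ : Fin n → ℝ)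
    (e : Fin n → EuclideanSpace ℝ (Fin (n + 1))) : Prop where
  orthonormal : Orthonormal ℝ e
  tangent : ∀ μ, e μ ∈ tangentVectorsAt S p
  eigen : ∀ μ, weingartenMap N p (e μ) = κ μ • e μ

/-- The spherical component: the connected component of the complement of `S` in the ball of radius
`ε` around `p` into which the vector `N p` points. -/
def sphericalComponent {n : ℕ} (S : Set (EuclideanSpace ℝ (Fin (n + 1))))
    (N : EuclideanSpace ℝ (Fin (n + 1)) → EuclideanSpace ℝ (Fin (n + 1)))
    (p : EuclideanSpace ℝ (Fin (n + 1))) (ε : ℝ) : Set (EuclideanSpace ℝ (Fin (n + 1))) :=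
  {x | ∀ᶠ t in 𝓝[>] (0 : ℝ), p + t • N p ∈ connectedComponentIn (Metric.closedBall p ε \ S) x}

/-- The barycenter of a domain. -/
def barycenterOf {m : ℕ} (D : Set (EuclideanSpace ℝ (Fin m))) : EuclideanSpace ℝ (Fin m) :=
  (volume.real D)⁻¹ • ∫ x in D, x

/-- The (unnormalized) covariance matrix of a domain, in the standard basis. -/
def covarianceMatrix {m : ℕ} (D : Set (EuclideanSpace ℝ (Fin m))) : Matrix (Fin m) (Fin m) ℝ :=
  Matrix.of fun i j => ∫ x in D, (x i - barycenterOf D i) * (x j - barycenterOf D j)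

/-- The volume of the `m`-dimensional ball of radius `ε`. -/
def ballVolume (m : ℕ) (ε : ℝ) : ℝ :=
  volume.real (Metric.closedBall (0 : EuclideanSpace ℝ (Fin m)) ε)

/-- The distance of two vectors up to sign. Unit eigenvectors of a simple eigenvalue are determined
only up to sign. -/
def distUpToSign {n : ℕ} (u w : EuclideanSpace ℝ (Fin n)) : ℝ :=
  min ‖u - w‖ ‖u + w‖

end

/-!
# Covariance of the spherical component of a hypersurface

Near `p` the hypersurface is the zero set of a function `f` that increases along the normal. Two
facts describe the spherical component in a small ball of radius `ε`. First, it is the whole of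
`{f > 0}`: this set is star-shaped about the point at height `ε / 2` on the normal
(`sphericalComponent_eq_pos`). Second, since `df` is a multiple of the pairing with the unit normal
along the hypersurface, the tangential Hessian of `f` is `-df(N)` times the second fundamental form
(`fderiv_fderiv_tangent`), so that `{f > 0}` lies above the osculating quadric
`z = ½ ∑ κ_μ y_μ²` up to a layer of thickness `O(ε³)` (`exists_sign_of_second_order`).

Magnifying by `1 / ε` gives a region `R_ε` of the unit ball of `ℝⁿ × ℝ`, which is the part above the
graph of `ε q`, with `q = ½ ∑ κ_μ y_μ²`, up to `O(ε²)`. For a fixed function `g`,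
`∫_{R_ε} g = ∫_{z > 0} g - ε ∫_{z = 0} g q + O(ε²)`
(`exists_bound_setIntegral_near_upperHalfBall`), and the integrals on the right are moments of
degree at most four of unit balls, known from their symmetries. With `g` the monomials of degree
at most two, this shows that in the frame of the principal directions and the normal the covariance
matrix is the diagonal matrix of the asserted leading terms up to `O(ε ^ (n + 5))`
(`diagonalDefect_isBigO`).

The rest is perturbation theory of symmetric matrices. Weyl's inequality, for increasing
rearrangements, labels the eigenvalues (`exists_eigenvalue_labelling`). The components of an
eigenvector along the other frame vectors are at most the error divided by the spectral
gap (`distUpToSign_isBigO`); the gap is of order `ε ^ (n + 4)` between principal directions and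
`ε ^ (n + 3)` between a principal direction and the normal, whence the two rates of convergence.
-/


/-! ### Perturbation of eigenvalues and eigenvectors -/

/-- One half of Weyl's inequality: if a function `Q` (in the applications, a quadratic form) is
within `δ ‖x‖²` and `δ' ‖x‖²` of two diagonal quadratic forms with increasing entries, then the
entries are ordered up to `δ + δ'`. The test vector is orthogonal to the first `k` vectors of one
basis and the last ones of the other, which are only `m - 1` linear conditions. -/
lemma le_add_of_near_diagonal {E : Type*} [NormedAddCommGroup E] [InnerProductSpace ℝ E]
    [FiniteDimensional ℝ E] {m : ℕ} (Q : E → ℝ) (b b' : OrthonormalBasis (Fin m) ℝ E)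
    {d d' : Fin m → ℝ} (hd : Monotone d) (hd' : Monotone d') {δ δ' : ℝ}
    (hb : ∀ x, |Q x - ∑ i, d i * inner ℝ (b i) x ^ 2| ≤ δ * ‖x‖ ^ 2)
    (hb' : ∀ x, |Q x - ∑ i, d' i * inner ℝ (b' i) x ^ 2| ≤ δ' * ‖x‖ ^ 2) (k : Fin m) :
    d k ≤ d' k + (δ + δ') := by
  classical
  let φ : E →ₗ[ℝ] ({i : Fin m // i ≠ k} → ℝ) :=
    LinearMap.pi fun i => (innerSL ℝ (if i.1 < k then b i.1 else b' i.1)).toLinearMap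
  have hker : LinearMap.ker φ ≠ ⊥ := by
    apply LinearMap.ker_ne_bot_of_finrank_lt
    rw [Module.finrank_fintype_fun_eq_card, Module.finrank_eq_card_basis b.toBasis]
    simp only [ne_eq, Fintype.card_subtype_compl, Fintype.card_fin, Fintype.card_unique]
    have := k.pos
    omega
  obtain ⟨x, hx, hx0⟩ := Submodule.exists_mem_ne_zero_of_ne_bot hker
  have hφ : ∀ i : Fin m, i ≠ k → inner ℝ (if i < k then b i else b' i) x = 0 := fun i hi => by
    have := congrFun (LinearMap.mem_ker.1 hx) ⟨i, hi⟩
    simpa [φ] using this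
  have hpos : 0 < ‖x‖ ^ 2 := by positivity
  have h1 : d k * ‖x‖ ^ 2 ≤ ∑ i, d i * inner ℝ (b i) x ^ 2 := by
    have hs := b.sum_sq_norm_inner_right x
    simp only [Real.norm_eq_abs, sq_abs] at hs
    rw [← hs, Finset.mul_sum]
    refine Finset.sum_le_sum fun i _ => ?_
    rcases lt_or_ge i k with h | h
    · have := hφ i h.ne
      rw [if_pos h] at this
      simp [this]
    · exact mul_le_mul_of_nonneg_right (hd h) (sq_nonneg _)
  have h2 : ∑ i, d' i * inner ℝ (b' i) x ^ 2 ≤ d' k * ‖x‖ ^ 2 := by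
    have hs := b'.sum_sq_norm_inner_right x
    simp only [Real.norm_eq_abs, sq_abs] at hs
    rw [← hs, Finset.mul_sum]
    refine Finset.sum_le_sum fun i _ => ?_
    rcases lt_or_ge k i with h | h
    · have := hφ i h.ne'
      rw [if_neg h.not_gt] at this
      simp [this]
    · exact mul_le_mul_of_nonneg_right (hd' h) (sq_nonneg _)
  have h3 := (abs_le.1 (hb x)).1
  have h4 := (abs_le.1 (hb' x)).2
  have h5 : d k * ‖x‖ ^ 2 ≤ (d' k + (δ + δ')) * ‖x‖ ^ 2 := by linarith
  exact le_of_mul_le_mul_right h5 hpos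

/-- Total deviation of the matrix of `T` in the orthonormal basis `b` from the diagonal matrix with
entries `d`. -/
noncomputable def diagonalDefect {E : Type*} [NormedAddCommGroup E] [InnerProductSpace ℝ E] {m : ℕ}
    (T : E →ₗ[ℝ] E) (b : OrthonormalBasis (Fin m) ℝ E) (d : Fin m → ℝ) : ℝ :=
  ∑ i, ∑ j, |inner ℝ (b i) (T (b j)) - if i = j then d i else 0|

lemma abs_inner_sub_le_diagonalDefect {E : Type*} [NormedAddCommGroup E] [InnerProductSpace ℝ E]
    {m : ℕ} (T : E →ₗ[ℝ] E) (b : OrthonormalBasis (Fin m) ℝ E) (d : Fin m → ℝ) (x : E) :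
    |inner ℝ x (T x) - ∑ i, d i * inner ℝ (b i) x ^ 2| ≤ diagonalDefect T b d * ‖x‖ ^ 2 := by
  have hx : inner ℝ x (T x) = ∑ i, ∑ j, inner ℝ (b i) x * inner ℝ (b j) x *
      inner ℝ (b i) (T (b j)) := by
    conv_lhs => rw [← b.sum_repr' x]
    simp only [map_sum, map_smul, sum_inner, inner_sum, inner_smul_left, inner_smul_right,
      RCLike.conj_to_real]
    rw [Finset.sum_comm]
    refine Finset.sum_congr rfl fun i _ => ?_
    rw [Finset.mul_sum]
    exact Finset.sum_congr rfl fun j _ => by ring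
  have hd : ∑ i, d i * inner ℝ (b i) x ^ 2 = ∑ i, ∑ j, inner ℝ (b i) x * inner ℝ (b j) x *
      (if i = j then d i else 0) := by
    refine Finset.sum_congr rfl fun i _ => ?_
    simp only [mul_ite, mul_zero, Finset.sum_ite_eq, Finset.mem_univ, if_true]
    ring
  rw [hx, hd, ← Finset.sum_sub_distrib, diagonalDefect, Finset.sum_mul]
  refine (Finset.abs_sum_le_sum_abs _ _).trans (Finset.sum_le_sum fun i _ => ?_)
  rw [← Finset.sum_sub_distrib, Finset.sum_mul]
  refine (Finset.abs_sum_le_sum_abs _ _).trans (Finset.sum_le_sum fun j _ => ?_)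
  rw [← mul_sub, abs_mul, mul_comm]
  refine mul_le_mul_of_nonneg_left ?_ (abs_nonneg _)
  have hle : ∀ i, |inner ℝ (b i) x| ≤ ‖x‖ := fun i => by
    simpa [b.orthonormal.1 i] using abs_real_inner_le_norm (b i) x
  rw [abs_mul, sq]
  exact mul_le_mul (hle i) (hle j) (abs_nonneg _) (norm_nonneg _)

/-- The eigenvalues of a symmetric matrix can be labelled so that they are close to the diagonal
entries of a nearby matrix that is diagonal in some orthonormal basis. The labelling matches
the two increasing rearrangements. -/
lemma exists_eigenvalue_labelling {m : ℕ} (A : Matrix (Fin m) (Fin m) ℝ) (hA : A.IsHermitian)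
    (b : OrthonormalBasis (Fin m) ℝ (EuclideanSpace ℝ (Fin m))) (d : Fin m → ℝ) :
    ∃ eig : Fin m → ℝ, A.charpoly = ∏ i, (Polynomial.X - Polynomial.C (eig i)) ∧
      ∀ i, |eig i - d i| ≤ diagonalDefect (Matrix.toEuclideanLin A) b d := by
  set σ := Tuple.sort hA.eigenvalues with hσ
  set τ := Tuple.sort d with hτ
  have hσm : Monotone (hA.eigenvalues ∘ σ) := Tuple.monotone_sort _
  have hτm : Monotone (d ∘ τ) := Tuple.monotone_sort _
  refine ⟨fun i => hA.eigenvalues (σ (τ.symm i)), ?_, fun i => ?_⟩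
  · rw [hA.charpoly_eq]
    exact (Equiv.prod_comp (τ.symm.trans σ)
      fun i => (Polynomial.X - Polynomial.C (hA.eigenvalues i : ℝ))).symm
  · set T := Matrix.toEuclideanLin A
    have hv : ∀ j, T (hA.eigenvectorBasis j) = hA.eigenvalues j • hA.eigenvectorBasis j := by
      intro j
      have := hA.mulVec_eigenvectorBasis j
      ext l
      simpa [T, Matrix.toLpLin_apply] using congrFun this l
    have hdef : diagonalDefect T hA.eigenvectorBasis hA.eigenvalues = 0 := by
      unfold diagonalDefect
      refine Finset.sum_eq_zero fun i _ => Finset.sum_eq_zero fun j _ => ?_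
      rw [hv, inner_smul_right, orthonormal_iff_ite.1 hA.eigenvectorBasis.orthonormal]
      split_ifs with h
      · simp [h]
      · simp
    have h1 : ∀ x, |inner ℝ x (T x) - ∑ i, (hA.eigenvalues ∘ σ) i *
        inner ℝ (hA.eigenvectorBasis.reindex σ.symm i) x ^ 2| ≤ 0 * ‖x‖ ^ 2 := fun x => by
      have := abs_inner_sub_le_diagonalDefect T hA.eigenvectorBasis hA.eigenvalues x
      rw [hdef] at this
      rw [← Equiv.sum_comp σ] at this
      simpa using this
    have h2 : ∀ x, |inner ℝ x (T x) - ∑ i, (d ∘ τ) i *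
        inner ℝ (b.reindex τ.symm i) x ^ 2| ≤ diagonalDefect T b d * ‖x‖ ^ 2 := fun x => by
      have := abs_inner_sub_le_diagonalDefect T b d x
      rw [← Equiv.sum_comp τ] at this
      simpa using this
    have h3 := le_add_of_near_diagonal _ _ _ hσm hτm h1 h2 (τ.symm i)
    have h4 := le_add_of_near_diagonal _ _ _ hτm hσm h2 h1 (τ.symm i)
    simp only [Function.comp, Equiv.apply_symm_apply] at h3 h4
    rw [abs_le]
    constructor <;> linarith

/-- The components of a unit eigenvector along the other vectors of an almost diagonalizing
basis are small, in the ratio of the diagonal defect to the spectral gap. -/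
lemma abs_inner_le_of_eigenvector {E : Type*} [NormedAddCommGroup E] [InnerProductSpace ℝ E]
    {m : ℕ} (T : E →ₗ[ℝ] E) (b : OrthonormalBasis (Fin m) ℝ E) (d : Fin m → ℝ) {v : E} {l : ℝ}
    (hv : ‖v‖ = 1) (hT : T v = l • v) (k : Fin m) :
    |l - d k| * |inner ℝ (b k) v| ≤ diagonalDefect T b d := by
  have h1 : inner ℝ (b k) (T v) = ∑ j, inner ℝ (b j) v * inner ℝ (b k) (T (b j)) := by
    conv_lhs => rw [← b.sum_repr' v]
    simp only [map_sum, map_smul, inner_sum, inner_smul_right]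
  have h2 : (l - d k) * inner ℝ (b k) v =
      ∑ j, inner ℝ (b j) v * (inner ℝ (b k) (T (b j)) - if k = j then d k else 0) := by
    simp only [mul_sub, Finset.sum_sub_distrib, ← h1, hT, inner_smul_right]
    simp [sub_mul, mul_comm]
  rw [← abs_mul, h2]
  refine (Finset.abs_sum_le_sum_abs _ _).trans ?_
  calc _ ≤ ∑ j, |inner ℝ (b k) (T (b j)) - if k = j then d k else 0| := by
        refine Finset.sum_le_sum fun j _ => ?_
        rw [abs_mul]
        refine mul_le_of_le_one_left (abs_nonneg _) ?_
        simpa [b.orthonormal.1 j, hv] using abs_real_inner_le_norm (b j) v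
    _ ≤ _ := Finset.single_le_sum (f := fun i => ∑ j, |inner ℝ (b i) (T (b j)) -
        if i = j then d i else 0|) (fun i _ => Finset.sum_nonneg fun j _ => abs_nonneg _)
        (Finset.mem_univ k)

/-- A unit vector is as close, up to sign, to a basis vector as its other components are small. -/
lemma distUpToSign_le {m : ℕ} (b : OrthonormalBasis (Fin m) ℝ (EuclideanSpace ℝ (Fin m)))
    {v : EuclideanSpace ℝ (Fin m)} (hv : ‖v‖ = 1) (i : Fin m) {r : ℝ} (hr : 0 ≤ r)
    (h : ∀ k, k ≠ i → |inner ℝ (b k) v| ≤ r) : distUpToSign v (b i) ≤ 2 * m * r := by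
  set a := inner ℝ (b i) v with ha
  have hs := b.sum_sq_norm_inner_right v
  simp only [Real.norm_eq_abs, sq_abs, hv] at hs
  rw [← Finset.add_sum_erase _ _ (Finset.mem_univ i), ← ha] at hs
  have hle : ∑ k ∈ Finset.univ.erase i, inner ℝ (b k) v ^ 2 ≤ m * r ^ 2 := by
    calc _ ≤ ∑ k ∈ Finset.univ.erase i, r ^ 2 := Finset.sum_le_sum fun k hk => by
          have := h k (Finset.ne_of_mem_erase hk)
          rw [← sq_abs]
          exact pow_le_pow_left₀ (abs_nonneg _) this 2
      _ ≤ _ := by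
          rw [Finset.sum_const, nsmul_eq_mul]
          refine mul_le_mul_of_nonneg_right ?_ (sq_nonneg _)
          exact_mod_cast (Finset.card_le_univ _).trans (by simp)
  have hm : (1 : ℝ) ≤ m := by exact_mod_cast i.pos
  have hb : ‖b i‖ = 1 := b.orthonormal.1 i
  have key : ∀ s : ℝ, s ^ 2 = 1 → 0 ≤ s * a → ‖v - s • b i‖ ≤ 2 * m * r := by
    intro s hs1 hsa
    have h1 : ‖v - s • b i‖ ^ 2 = 2 - 2 * (s * a) := by
      rw [norm_sub_sq_real, norm_smul, mul_pow, hv, hb, inner_smul_right, real_inner_comm, ← ha,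
        Real.norm_eq_abs, sq_abs, hs1]
      ring
    have h2 : (s * a) ^ 2 = a ^ 2 := by rw [mul_pow, hs1, one_mul]
    have h0 : 0 ≤ ∑ k ∈ Finset.univ.erase i, inner ℝ (b k) v ^ 2 :=
      Finset.sum_nonneg fun k _ => sq_nonneg _
    have h3 : s * a ≤ 1 := by nlinarith
    have h4 : ‖v - s • b i‖ ^ 2 ≤ (2 * m * r) ^ 2 := by
      rw [h1]
      have h5 : m * r ^ 2 ≤ m * (m * r ^ 2) := le_mul_of_one_le_left (by positivity) hm
      nlinarith
    exact le_of_sq_le_sq h4 (by positivity)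
  unfold distUpToSign
  rcases le_total 0 a with h0 | h0
  · exact (min_le_left _ _).trans (by simpa using key 1 (by norm_num) (by simpa using h0))
  · exact (min_le_right _ _).trans (by simpa using key (-1) (by norm_num) (by simpa using h0))

/-! ### Moments of the unit ball -/

/-- The closed unit ball of `ℝᵈ`. -/
abbrev unitBall (d : ℕ) : Set (EuclideanSpace ℝ (Fin d)) := Metric.closedBall 0 1

lemma ballVolume_eq (d : ℕ) {ε : ℝ} (hε : 0 ≤ ε) :
    ballVolume d ε = ε ^ d * ballVolume d 1 := by
  unfold ballVolume
  rw [Measure.addHaar_real_closedBall' _ _ hε]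
  simp

lemma ballVolume_one_pos (d : ℕ) : 0 < ballVolume d 1 := by
  unfold ballVolume
  exact ENNReal.toReal_pos (Metric.measure_closedBall_pos _ _ one_pos).ne'
    measure_closedBall_lt_top.ne

lemma integrableOn_unitBall {d : ℕ} {g : EuclideanSpace ℝ (Fin d) → ℝ} (hg : Continuous g) :
    IntegrableOn g (unitBall d) :=
  hg.continuousOn.integrableOn_compact (isCompact_closedBall _ _)

lemma setIntegral_unitBall_comp {d : ℕ}
    (L : EuclideanSpace ℝ (Fin d) ≃ₗᵢ[ℝ] EuclideanSpace ℝ (Fin d))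
    (g : EuclideanSpace ℝ (Fin d) → ℝ) :
    ∫ x in unitBall d, g (L x) = ∫ x in unitBall d, g x := by
  have h := L.measurePreserving.setIntegral_preimage_emb
    L.toHomeomorph.measurableEmbedding g (unitBall d)
  have h2 : L ⁻¹' unitBall d = unitBall d := by
    ext x; simp
  rwa [h2] at h

/-- The reflection in the `i`-th coordinate hyperplane. -/
noncomputable def coordFlip {d : ℕ} (i : Fin d) :
    EuclideanSpace ℝ (Fin d) ≃ₗᵢ[ℝ] EuclideanSpace ℝ (Fin d) :=
  ((ℝ ∙ EuclideanSpace.single i (1 : ℝ))ᗮ).reflection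

lemma coordFlip_apply {d : ℕ} (i j : Fin d) (x : EuclideanSpace ℝ (Fin d)) :
    coordFlip i x j = if j = i then -x j else x j := by
  rw [coordFlip, Submodule.reflection_orthogonal_apply, Submodule.reflection_singleton_apply]
  simp only [EuclideanSpace.inner_single_left, PiLp.norm_single, PiLp.neg_apply,
    PiLp.sub_apply, PiLp.smul_apply, PiLp.single_apply]
  split_ifs with h
  · subst h; simp; ring
  · simp

lemma setIntegral_unitBall_eq_zero_of_flip {d : ℕ} (i : Fin d) {g : EuclideanSpace ℝ (Fin d) → ℝ}
    (hg : ∀ x, g (coordFlip i x) = -g x) : ∫ x in unitBall d, g x = 0 := by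
  have h := setIntegral_unitBall_comp (coordFlip i) g
  simp only [hg, integral_neg] at h
  linarith

lemma setIntegral_unitBall_inner_eq {d : ℕ} {u w : EuclideanSpace ℝ (Fin d)} (h : ‖u‖ = ‖w‖)
    (F : ℝ → ℝ) :
    ∫ x in unitBall d, F (inner ℝ u x) = ∫ x in unitBall d, F (inner ℝ w x) := by
  set L := ((ℝ ∙ (u - w))ᗮ).reflection with hL
  rw [← setIntegral_unitBall_comp L fun x => F (inner ℝ w x)]
  have hLu : L u = w := Submodule.reflection_sub h
  congr 1
  ext x
  rw [← hLu, LinearIsometryEquiv.inner_map_map]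

lemma setIntegral_unitBall_norm_pow {d : ℕ} (k : ℕ) (hk : 0 < k) :
    ∫ x in unitBall d, ‖x‖ ^ k = d / (d + k) * ballVolume d 1 := by
  have hk' : (0 : ℝ) < k := by exact_mod_cast hk
  rcases Nat.eq_zero_or_pos d with rfl | hd
  · have : ∀ x : EuclideanSpace ℝ (Fin 0), ‖x‖ ^ k = 0 := fun x => by
      rw [Subsingleton.elim x 0, norm_zero, zero_pow hk.ne']
    simp [this]
  have hne : Nonempty (Fin d) := ⟨⟨0, hd⟩⟩
  have hdR : (0 : ℝ) < d := by exact_mod_cast hd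
  have h := integral_fun_norm_addHaar (volume : Measure (EuclideanSpace ℝ (Fin d)))
    (Set.indicator (Set.Iic 1) fun r : ℝ => r ^ k)
  have h1 : ∀ x : EuclideanSpace ℝ (Fin d), Set.indicator (Set.Iic 1) (fun r : ℝ => r ^ k) ‖x‖ =
      Set.indicator (unitBall d) (fun x => ‖x‖ ^ k) x := fun x => by
    classical simp only [Set.indicator_apply, Set.mem_Iic, mem_closedBall_zero_iff]
  simp only [h1] at h
  rw [integral_indicator measurableSet_closedBall] at h
  rw [h, finrank_euclideanSpace_fin, ← Measure.addHaar_real_closedBall_eq_addHaar_real_ball]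
  have h2 : ∫ y in Set.Ioi (0 : ℝ), y ^ (d - 1) • Set.indicator (Set.Iic 1) (fun r : ℝ => r ^ k) y
      = ∫ y in (0 : ℝ)..1, y ^ (d - 1 + k) := by
    rw [intervalIntegral.integral_of_le zero_le_one, ← Set.Ioi_inter_Iic,
      ← setIntegral_indicator measurableSet_Iic]
    congr 1
    ext y
    simp only [Set.indicator_apply, smul_eq_mul, mul_ite, mul_zero, pow_add]
  rw [h2, integral_pow]
  have h3 : ((d - 1 + k : ℕ) : ℝ) + 1 = d + k := by
    have : d - 1 + k + 1 = d + k := by omega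
    exact_mod_cast this
  rw [h3]
  simp only [nsmul_eq_mul, smul_eq_mul, ballVolume]
  simp
  ring

lemma setIntegral_unitBall_sq {d : ℕ} (i : Fin d) :
    ∫ x in unitBall d, x i ^ 2 = ballVolume d 1 / (d + 2) := by
  have hd : (0 : ℝ) < d := by exact_mod_cast i.pos
  have hi : ∀ j, ∫ x in unitBall d, x j ^ 2 = ∫ x in unitBall d, x i ^ 2 := fun j => by
    have := setIntegral_unitBall_inner_eq (u := EuclideanSpace.single j (1 : ℝ))
      (w := EuclideanSpace.single i (1 : ℝ)) (by simp) fun t => t ^ 2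
    simpa [EuclideanSpace.inner_single_left] using this
  have h := setIntegral_unitBall_norm_pow (d := d) 2 two_pos
  simp only [EuclideanSpace.real_norm_sq_eq] at h
  rw [integral_finsetSum _ fun j _ => integrableOn_unitBall (by fun_prop)] at h
  simp only [hi, Finset.sum_const, Finset.card_univ, Fintype.card_fin, nsmul_eq_mul] at h
  field_simp at h ⊢
  push_cast at h
  linarith

lemma setIntegral_unitBall_mul {d : ℕ} (i j : Fin d) :
    ∫ x in unitBall d, x i * x j = if i = j then ballVolume d 1 / (d + 2) else 0 := by
  split_ifs with h
  · subst h
    simp only [← sq]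
    exact setIntegral_unitBall_sq i
  · refine setIntegral_unitBall_eq_zero_of_flip i fun x => ?_
    simp [coordFlip_apply, Ne.symm h]

/-- The fourth moments of the ball. The ratio `3` between the two kinds comes from the invariance
of `∫ ⟪u, x⟫⁴` under rotations, applied to `u = eᵢ ± eⱼ` and `√2 eᵢ`; the normalization from
`∫ ‖x‖⁴`. -/
lemma setIntegral_unitBall_sq_mul_sq {d : ℕ} (i j : Fin d) :
    ∫ x in unitBall d, x i ^ 2 * x j ^ 2 =
      (if i = j then 3 else 1) * (ballVolume d 1 / ((d + 2) * (d + 4))) := by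
  have hd : (0 : ℝ) < d := by exact_mod_cast i.pos
  have hi : ∀ j, ∫ x in unitBall d, x j ^ 4 = ∫ x in unitBall d, x i ^ 4 := fun j => by
    have := setIntegral_unitBall_inner_eq (u := EuclideanSpace.single j (1 : ℝ))
      (w := EuclideanSpace.single i (1 : ℝ)) (by simp) fun t => t ^ 4
    simpa [EuclideanSpace.inner_single_left] using this
  set A := ∫ x in unitBall d, x i ^ 4 with hA
  have hC : ∀ j k : Fin d, ∫ x in unitBall d, x j ^ 2 * x k ^ 2 =
      (if j = k then 3 else 1) * (A / 3) := by
    intro j k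
    split_ifs with h
    · subst h
      simp only [← pow_add]
      rw [hi]; ring
    have hn : ∀ s : ℝ, s ^ 2 = 1 → ‖EuclideanSpace.single j (1 : ℝ) + EuclideanSpace.single k s‖ =
        ‖EuclideanSpace.single j (√2)‖ := fun s hs => by
      rw [PiLp.norm_single, EuclideanSpace.norm_eq, Real.norm_of_nonneg (by positivity)]
      congr 1
      simp only [PiLp.add_apply, PiLp.single_apply, Real.norm_eq_abs, sq_abs]
      rw [Finset.sum_congr rfl (g := fun l => (if l = j then (1 : ℝ) else 0) +
        (if l = k then 1 else 0))]
      · rw [Finset.sum_add_distrib]; simp; norm_num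
      · intro l _
        by_cases h1 : l = j
        · subst h1; simp [h]
        · simp [h1, hs]
    have h4 : ∀ s : ℝ, s ^ 2 = 1 → ∫ x in unitBall d, (x j + s * x k) ^ 4 = 4 * A := by
      intro s hs
      have := setIntegral_unitBall_inner_eq (hn s hs) fun t => t ^ 4
      simp only [inner_add_left, EuclideanSpace.inner_single_left, mul_pow] at this
      rw [integral_const_mul, hi] at this
      simp only [RCLike.conj_to_real, one_mul] at this
      rw [this]
      congr 1
      rw [show (4 : ℕ) = 2 * 2 by norm_num, pow_mul, Real.sq_sqrt (by norm_num)]; norm_num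
    have h5 := h4 1 (by norm_num)
    have h6 := h4 (-1) (by norm_num)
    have h7 : ∫ x in unitBall d, ((x j + 1 * x k) ^ 4 + (x j + -1 * x k) ^ 4) = 8 * A := by
      rw [integral_add (integrableOn_unitBall (by fun_prop)) (integrableOn_unitBall (by fun_prop)),
        h5, h6]
      ring
    have h8 : ∀ x : EuclideanSpace ℝ (Fin d), (x j + 1 * x k) ^ 4 + (x j + -1 * x k) ^ 4 =
        2 * x j ^ 4 + 2 * x k ^ 4 + 12 * (x j ^ 2 * x k ^ 2) := fun x => by ring
    simp only [h8] at h7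
    rw [integral_add (integrableOn_unitBall (by fun_prop)) (integrableOn_unitBall (by fun_prop)),
      integral_add (integrableOn_unitBall (by fun_prop)) (integrableOn_unitBall (by fun_prop)),
      integral_const_mul, integral_const_mul, integral_const_mul, hi, hi] at h7
    linarith
  have h := setIntegral_unitBall_norm_pow (d := d) 4 (by norm_num)
  have hn : ∀ x : EuclideanSpace ℝ (Fin d), ‖x‖ ^ 4 = ∑ j, ∑ k, x j ^ 2 * x k ^ 2 := fun x => by
    rw [show (4 : ℕ) = 2 * 2 by norm_num, pow_mul, EuclideanSpace.real_norm_sq_eq, sq,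
      Finset.sum_mul_sum]
  simp only [hn] at h
  rw [integral_finsetSum _ fun j _ => integrableOn_unitBall (by fun_prop)] at h
  have h9 : ∀ j : Fin d, ∫ x in unitBall d, ∑ k, x j ^ 2 * x k ^ 2 = (d + 2) * (A / 3) := by
    intro j
    rw [integral_finsetSum _ fun k _ => integrableOn_unitBall (by fun_prop)]
    simp only [hC, ← Finset.sum_mul]
    congr 1
    rw [Finset.sum_congr rfl (g := fun k => (1 : ℝ) + if j = k then 2 else 0)]
    · rw [Finset.sum_add_distrib]; simp
    · intro k _
      split_ifs <;> norm_num
  simp only [h9, Finset.sum_const, Finset.card_univ, Fintype.card_fin, nsmul_eq_mul] at h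
  rw [hC]
  congr 1
  push_cast at h
  field_simp at h ⊢
  linarith

lemma setIntegral_unitBall_mul_mul_sq {d : ℕ} (i j k : Fin d) :
    ∫ x in unitBall d, x i * x j * x k ^ 2 =
      if i = j then (if i = k then 3 else 1) * (ballVolume d 1 / ((d + 2) * (d + 4))) else 0 := by
  split_ifs with h hk
  · subst h hk
    simpa [sq] using setIntegral_unitBall_sq_mul_sq i i
  · subst h
    simp only [← sq]
    simpa [hk] using setIntegral_unitBall_sq_mul_sq i k
  · refine setIntegral_unitBall_eq_zero_of_flip i fun x => ?_
    simp only [coordFlip_apply, Ne.symm h, if_true, if_false]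
    split_ifs <;> ring

/-! ### Integration over thin perturbations of the half-ball -/

/-- The closed unit ball of `ℝⁿ⁺¹`, in the splitting `ℝⁿ × ℝ`. -/
def splitBall (n : ℕ) : Set (EuclideanSpace ℝ (Fin n) × ℝ) := {w | ‖w.1‖ ^ 2 + w.2 ^ 2 ≤ 1}

/-- The upper half of the unit ball of `ℝⁿ × ℝ`. -/
def upperHalfBall (n : ℕ) : Set (EuclideanSpace ℝ (Fin n) × ℝ) := {w ∈ splitBall n | 0 < w.2}

/-- The cylinder over the unit ball of `ℝⁿ` that contains the unit ball of `ℝⁿ × ℝ`. -/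
def splitCylinder (n : ℕ) : Set (EuclideanSpace ℝ (Fin n) × ℝ) := unitBall n ×ˢ Set.Icc (-1) 1

lemma isClosed_splitBall (n : ℕ) : IsClosed (splitBall n) :=
  isClosed_le (by fun_prop) continuous_const

lemma measurableSet_upperHalfBall (n : ℕ) : MeasurableSet (upperHalfBall n) :=
  (isClosed_splitBall n).measurableSet.inter (measurableSet_lt measurable_const measurable_snd)

lemma splitBall_subset_splitCylinder (n : ℕ) : splitBall n ⊆ splitCylinder n := by
  intro w hw
  have hw : ‖w.1‖ ^ 2 + w.2 ^ 2 ≤ 1 := hw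
  refine ⟨?_, ?_⟩
  · rw [mem_closedBall_zero_iff]
    nlinarith [norm_nonneg w.1]
  · rw [Set.mem_Icc, ← abs_le]
    rw [← sq_le_one_iff_abs_le_one]
    nlinarith [norm_nonneg w.1]

lemma upperHalfBall_subset_splitCylinder (n : ℕ) : upperHalfBall n ⊆ splitCylinder n :=
  fun _ hw => splitBall_subset_splitCylinder n hw.1

lemma isCompact_splitCylinder (n : ℕ) : IsCompact (splitCylinder n) :=
  (isCompact_closedBall _ _).prod isCompact_Icc

lemma integrableOn_of_subset_splitCylinder {n : ℕ} {g : EuclideanSpace ℝ (Fin n) × ℝ → ℝ}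
    (hg : Continuous g) {D : Set (EuclideanSpace ℝ (Fin n) × ℝ)} (hD : D ⊆ splitCylinder n) :
    IntegrableOn g D :=
  (hg.continuousOn.integrableOn_compact (isCompact_splitCylinder n)).mono_set hD

/-- Fubini's theorem for the part of the cylinder above a graph. -/
lemma setIntegral_above_graph {n : ℕ} {g : EuclideanSpace ℝ (Fin n) × ℝ → ℝ}
    (hg : Continuous g) {φ : EuclideanSpace ℝ (Fin n) → ℝ} (hφ : Measurable φ)
    (hφ1 : ∀ y ∈ unitBall n, |φ y| ≤ 1) :
    IntegrableOn (fun y => ∫ z in (φ y)..1, g (y, z)) (unitBall n) ∧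
    ∫ w in {w : EuclideanSpace ℝ (Fin n) × ℝ | w.1 ∈ unitBall n ∧ φ w.1 < w.2 ∧ w.2 ≤ 1}, g w =
      ∫ y in unitBall n, ∫ z in (φ y)..1, g (y, z) := by
  set D := {w : EuclideanSpace ℝ (Fin n) × ℝ | w.1 ∈ unitBall n ∧ φ w.1 < w.2 ∧ w.2 ≤ 1} with hD
  have hDm : MeasurableSet D :=
    (measurable_fst measurableSet_closedBall).inter
      ((measurableSet_lt (hφ.comp measurable_fst) measurable_snd).inter
        (measurableSet_le measurable_snd measurable_const))
  have hDs : D ⊆ splitCylinder n := fun w hw =>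
    ⟨hw.1, (abs_le.1 (hφ1 _ hw.1)).1.trans hw.2.1.le, hw.2.2⟩
  have hint : Integrable (D.indicator g) (volume.prod volume) :=
    (integrable_indicator_iff hDm).2 (integrableOn_of_subset_splitCylinder hg hDs)
  have hin : ∀ y, ∫ z, D.indicator g (y, z) =
      (unitBall n).indicator (fun y => ∫ z in (φ y)..1, g (y, z)) y := by
    intro y
    by_cases hy : y ∈ unitBall n
    · rw [Set.indicator_of_mem hy, intervalIntegral.integral_of_le (abs_le.1 (hφ1 y hy)).2,
        ← integral_indicator measurableSet_Ioc]
      congr 1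
      ext z
      classical
      simp only [Set.indicator_apply, hD, Set.mem_ofPred_eq, hy, true_and, Set.mem_Ioc]
    · rw [Set.indicator_of_notMem hy]
      have : ∀ z, D.indicator g (y, z) = 0 := fun z =>
        Set.indicator_of_notMem (fun h => hy h.1) _
      simp [this]
  constructor
  · rw [← integrable_indicator_iff measurableSet_closedBall]
    have := hint.integral_prod_left
    simpa only [hin] using this
  · rw [← integral_indicator hDm, ← integral_indicator measurableSet_closedBall,
      Measure.volume_eq_prod, integral_prod _ hint]
    simp only [hin]

/-- A thin annulus of the unit ball has volume at most linear in its width. -/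
lemma volume_annulus_le (n : ℕ) {s : ℝ} (h0 : 0 ≤ s) (h1 : s ≤ 1) :
    volume.real (unitBall n \ Metric.closedBall 0 (1 - s)) ≤ n * s * ballVolume n 1 := by
  have hsub : Metric.closedBall (0 : EuclideanSpace ℝ (Fin n)) (1 - s) ⊆ unitBall n :=
    Metric.closedBall_subset_closedBall (by linarith)
  rw [measureReal_sdiff hsub measurableSet_closedBall measure_closedBall_lt_top.ne]
  have h2 := ballVolume_eq n (sub_nonneg.2 h1)
  have h3 := one_add_mul_le_pow (a := -s) (by linarith) n
  have h4 := ballVolume_one_pos n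
  unfold ballVolume at *
  rw [h2]
  have h5 : (1 + n * -s) * volume.real (unitBall n) ≤ (1 - s) ^ n * volume.real (unitBall n) :=
    mul_le_mul_of_nonneg_right (by simpa [sub_eq_add_neg] using h3) h4.le
  linarith

/-- The layer of half-thickness `t` around a graph over the unit ball has volume at most `2 t ωₙ`. -/
lemma volume_layer_le {n : ℕ} {φ : EuclideanSpace ℝ (Fin n) → ℝ} (hφ : Measurable φ) {t : ℝ}
    (ht : 0 ≤ t) :
    MeasurableSet {w : EuclideanSpace ℝ (Fin n) × ℝ | w.1 ∈ unitBall n ∧ |w.2 - φ w.1| ≤ t} ∧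
    volume {w : EuclideanSpace ℝ (Fin n) × ℝ | w.1 ∈ unitBall n ∧ |w.2 - φ w.1| ≤ t} ≤
      ENNReal.ofReal (2 * t * ballVolume n 1) := by
  set D := {w : EuclideanSpace ℝ (Fin n) × ℝ | w.1 ∈ unitBall n ∧ |w.2 - φ w.1| ≤ t} with hD
  have hDm : MeasurableSet D :=
    (measurable_fst measurableSet_closedBall).inter
      (measurableSet_le ((measurable_snd.sub (hφ.comp measurable_fst)).abs) measurable_const)
  refine ⟨hDm, ?_⟩
  have hslice : ∀ y, volume (Prod.mk y ⁻¹' D) ≤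
      (unitBall n).indicator (fun _ => ENNReal.ofReal (2 * t)) y := by
    intro y
    by_cases hy : y ∈ unitBall n
    · rw [Set.indicator_of_mem hy]
      have : Prod.mk y ⁻¹' D ⊆ Set.Icc (φ y - t) (φ y + t) := fun z hz => by
        have := abs_le.1 hz.2
        constructor <;> simp only at this ⊢ <;> linarith
      refine (measure_mono this).trans ?_
      rw [Real.volume_Icc]
      apply le_of_eq; congr 1; ring
    · have : Prod.mk y ⁻¹' D = ∅ := Set.eq_empty_of_forall_notMem fun z hz => hy hz.1
      simp [this]
  rw [Measure.volume_eq_prod, Measure.prod_apply hDm]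
  refine (lintegral_mono hslice).trans ?_
  rw [lintegral_indicator_const measurableSet_closedBall,
    ENNReal.ofReal_mul (p := 2 * t) (by linarith), ballVolume, measureReal_def,
    ENNReal.ofReal_toReal measure_closedBall_lt_top.ne]

/-- Integration over a region of the unit ball of `ℝⁿ × ℝ` that agrees, up to a layer of thickness
`O(ε²)`, with the part above the graph of `ε q`. To first order in `ε` the integral differs from
the one over the upper half-ball by the flux `ε ∫ g(y, 0) q(y)` through the equatorial disc.
Besides the layer, the only discrepancy between the region and the part of the cylinder
above the graph is a thin ring along the equator, with cross-section `O(ε) × O(ε)`. -/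
lemma exists_bound_setIntegral_near_upperHalfBall {n : ℕ} {q : EuclideanSpace ℝ (Fin n) → ℝ}
    (hq : Continuous q) {g : EuclideanSpace ℝ (Fin n) × ℝ → ℝ} (hg : Continuous g) {L : ℝ}
    (hL : ∀ y ∈ unitBall n, ∀ z : ℝ, |z| ≤ 1 → |g (y, z) - g (y, 0)| ≤ L * |z|)
    {K : ℝ} (hK : 0 ≤ K) :
    ∃ C : ℝ, ∃ ε₀ > 0, ∀ ε, 0 < ε → ε < ε₀ → ∀ D : Set (EuclideanSpace ℝ (Fin n) × ℝ),
      MeasurableSet D → D ⊆ splitBall n →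
      (∀ w ∈ splitBall n, ε * q w.1 + K * ε ^ 2 < w.2 → w ∈ D) →
      (∀ w ∈ splitBall n, w.2 < ε * q w.1 - K * ε ^ 2 → w ∉ D) →
      |(∫ w in D, g w) - (∫ w in upperHalfBall n, g w) + ε * ∫ y in unitBall n, g (y, 0) * q y| ≤
        C * ε ^ 2 := by
  obtain ⟨Q, hQ⟩ := (isCompact_closedBall (0 : EuclideanSpace ℝ (Fin n)) 1).exists_bound_of_continuousOn
    hq.continuousOn
  obtain ⟨M, hM⟩ := (isCompact_splitCylinder n).exists_bound_of_continuousOn hg.continuousOn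
  simp only [Real.norm_eq_abs] at hQ hM
  have h0 : (0 : EuclideanSpace ℝ (Fin n)) ∈ unitBall n := by simp
  have hQ0 : 0 ≤ Q := (abs_nonneg _).trans (hQ 0 h0)
  have hM0 : 0 ≤ M := (abs_nonneg _).trans (hM (0, 0) ⟨h0, by simp⟩)
  have hL0 : 0 ≤ L := by simpa using (abs_nonneg _).trans (hL 0 h0 1 (by simp))
  set R := Q + K with hR
  have hW := ballVolume_one_pos n
  set W := ballVolume n 1 with hWd
  refine ⟨M * (2 * K * W + n * R * W * (2 * R)) + L * Q ^ 2 * W, 1 / (R + 1), by positivity, ?_⟩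
  intro ε hε hε0 D hDm hDB hin hout
  rw [lt_div_iff₀ (by positivity)] at hε0
  have hRε : R * ε ≤ 1 := by nlinarith
  have hRε0 : 0 ≤ R * ε := by positivity
  have hεq : ∀ y ∈ unitBall n, |ε * q y| ≤ Q * ε := fun y hy => by
    rw [abs_mul, abs_of_pos hε, mul_comm]
    exact mul_le_mul_of_nonneg_right (hQ y hy) hε.le
  have hKε : 0 ≤ K * ε := by positivity
  have hεq1 : ∀ y ∈ unitBall n, |ε * q y| ≤ 1 := fun y hy => by
    have := hεq y hy
    have : R * ε = Q * ε + K * ε := by rw [hR]; ring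
    linarith
  -- the parts of the cylinder above the graph of `ε q` and above the equatorial disc
  set D₁ := {w : EuclideanSpace ℝ (Fin n) × ℝ | w.1 ∈ unitBall n ∧ ε * q w.1 < w.2 ∧ w.2 ≤ 1}
    with hD₁
  set D₂ := {w : EuclideanSpace ℝ (Fin n) × ℝ | w.1 ∈ unitBall n ∧ (0 : ℝ) < w.2 ∧ w.2 ≤ 1}
    with hD₂
  have hqm : Measurable fun y => ε * q y := (continuous_const.mul hq).measurable
  obtain ⟨hi₁, hI₁⟩ := setIntegral_above_graph hg hqm hεq1
  obtain ⟨hi₂, hI₂⟩ := setIntegral_above_graph hg (φ := fun _ => 0) measurable_const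
    (fun _ _ => by simp)
  have hD₁m : MeasurableSet D₁ :=
    (measurable_fst measurableSet_closedBall).inter
      ((measurableSet_lt (hqm.comp measurable_fst) measurable_snd).inter
        (measurableSet_le measurable_snd measurable_const))
  have hD₂m : MeasurableSet D₂ :=
    (measurable_fst measurableSet_closedBall).inter
      ((measurableSet_lt measurable_const measurable_snd).inter
        (measurableSet_le measurable_snd measurable_const))
  have hD₁s : D₁ ⊆ splitCylinder n := fun w hw =>
    ⟨hw.1, (abs_le.1 (hεq1 _ hw.1)).1.trans hw.2.1.le, hw.2.2⟩
  have hD₂s : D₂ ⊆ splitCylinder n := fun w hw =>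
    ⟨hw.1, by have := hw.2.1; simp only [Set.mem_Icc]; constructor <;> linarith [hw.2.2]⟩
  -- the exceptional sets: a layer around the graph and a ring around the equator
  set S₁ := {w : EuclideanSpace ℝ (Fin n) × ℝ | w.1 ∈ unitBall n ∧ |w.2 - ε * q w.1| ≤ K * ε ^ 2}
    with hS₁
  set S₂ : Set (EuclideanSpace ℝ (Fin n) × ℝ) :=
    (unitBall n \ Metric.closedBall 0 (1 - R * ε)) ×ˢ Set.Icc (-(R * ε)) (R * ε) with hS₂
  obtain ⟨hS₁m, hS₁v⟩ := volume_layer_le hqm (t := K * ε ^ 2) (by positivity)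
  have hS₂m : MeasurableSet S₂ :=
    (measurableSet_closedBall.diff measurableSet_closedBall).prod measurableSet_Icc
  have hS₂v : volume.real S₂ ≤ n * (R * ε) * W * (2 * (R * ε)) := by
    rw [hS₂, Measure.volume_eq_prod, measureReal_prod_prod]
    refine mul_le_mul (volume_annulus_le n hRε0 hRε) ?_ measureReal_nonneg (by positivity)
    rw [Real.volume_real_Icc_of_le (by linarith)]
    linarith
  have hS₂f : volume S₂ ≠ ⊤ := by
    rw [hS₂, Measure.volume_eq_prod, Measure.prod_prod]
    exact ENNReal.mul_ne_top ((measure_mono Set.sdiff_subset).trans_lt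
      measure_closedBall_lt_top).ne (by simp)
  have hS₁f : volume S₁ ≠ ⊤ := (hS₁v.trans_lt ENNReal.ofReal_lt_top).ne
  have hS₁r : volume.real S₁ ≤ 2 * (K * ε ^ 2) * W :=
    ENNReal.toReal_le_of_le_ofReal (by positivity) hS₁v
  set u : EuclideanSpace ℝ (Fin n) × ℝ → ℝ := fun w =>
    (D.indicator g w - (upperHalfBall n).indicator g w) - (D₁.indicator g w - D₂.indicator g w)
    with hu
  -- the four indicators cancel except on the layer and on the ring
  have hub : ∀ w, ‖u w‖ ≤ S₁.indicator (fun _ => M) w + S₂.indicator (fun _ => M) w := by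
    intro w
    classical
    have hn₁ : 0 ≤ S₁.indicator (fun _ => M) w := Set.indicator_nonneg (fun _ _ => hM0) w
    have hn₂ : 0 ≤ S₂.indicator (fun _ => M) w := Set.indicator_nonneg (fun _ _ => hM0) w
    by_cases hc : w ∈ splitCylinder n
    swap
    · have e1 : w ∉ D := fun h => hc (splitBall_subset_splitCylinder n (hDB h))
      have e2 : w ∉ upperHalfBall n := fun h => hc (upperHalfBall_subset_splitCylinder n h)
      have e3 : w ∉ D₁ := fun h => hc (hD₁s h)
      have e4 : w ∉ D₂ := fun h => hc (hD₂s h)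
      simp only [hu, Set.indicator_of_notMem e1, Set.indicator_of_notMem e2,
        Set.indicator_of_notMem e3, Set.indicator_of_notMem e4]
      simpa using add_nonneg hn₁ hn₂
    obtain ⟨hy, hz1⟩ := hc
    have m₁ : w ∈ D₁ ↔ ε * q w.1 < w.2 := ⟨fun h => h.2.1, fun h => ⟨hy, h, hz1.2⟩⟩
    have m₂ : w ∈ D₂ ↔ 0 < w.2 := ⟨fun h => h.2.1, fun h => ⟨hy, h, hz1.2⟩⟩
    have mh : w ∈ upperHalfBall n ↔ w ∈ splitBall n ∧ 0 < w.2 := Iff.rfl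
    have hgw : |g w| ≤ M := hM w ⟨hy, hz1⟩
    have hqw := abs_le.1 (hεq w.1 hy)
    have hRs : R * ε = Q * ε + K * ε := by rw [hR]; ring
    by_cases hB : w ∈ splitBall n
    · have mh' : w ∈ upperHalfBall n ↔ 0 < w.2 := by simp [mh, hB]
      by_cases hl : |w.2 - ε * q w.1| ≤ K * ε ^ 2
      · have hs : w ∈ S₁ := ⟨hy, hl⟩
        have : ‖u w‖ ≤ M := by
          simp only [hu, Set.indicator_apply, mh', m₂, Real.norm_eq_abs]
          split_ifs <;> simp <;> assumption
        rw [Set.indicator_of_mem hs]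
        linarith
      · have md : w ∈ D ↔ ε * q w.1 < w.2 := by
          rw [abs_le, not_and_or] at hl
          constructor
          · intro hD
            by_contra hlt
            refine hout w hB ?_ hD
            have hn : 0 ≤ K * ε ^ 2 := by positivity
            rcases hl with h | h <;> linarith
          · intro hlt
            refine hin w hB ?_
            have hn : 0 ≤ K * ε ^ 2 := by positivity
            rcases hl with h | h <;> linarith
        have : u w = 0 := by
          simp only [hu, Set.indicator_apply, mh', m₂, md, m₁, sub_self]
        rw [this, norm_zero]
        exact add_nonneg hn₁ hn₂
    · have md : w ∉ D := fun h => hB (hDB h)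
      have mh' : w ∉ upperHalfBall n := fun h => hB h.1
      by_cases hz : |w.2| ≤ R * ε
      · have hs : w ∈ S₂ := by
          refine ⟨⟨hy, fun hmem => hB ?_⟩, abs_le.1 hz⟩
          rw [mem_closedBall_zero_iff] at hmem
          have h3 : w.2 ^ 2 ≤ (R * ε) ^ 2 := by
            rw [← sq_abs]; exact pow_le_pow_left₀ (abs_nonneg _) hz 2
          have h4 : ‖w.1‖ ^ 2 ≤ (1 - R * ε) ^ 2 := pow_le_pow_left₀ (norm_nonneg _) hmem 2
          change ‖w.1‖ ^ 2 + w.2 ^ 2 ≤ 1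
          nlinarith
        have : ‖u w‖ ≤ M := by
          simp only [hu, Set.indicator_apply, mh', md, m₁, m₂, Real.norm_eq_abs, if_false]
          split_ifs <;> simp <;> assumption
        rw [Set.indicator_of_mem hs]
        linarith
      · have m12 : ε * q w.1 < w.2 ↔ 0 < w.2 := by
          rw [abs_le, not_and_or] at hz
          constructor <;> intro hlt <;> rcases hz with h | h <;> linarith
        have : u w = 0 := by
          simp only [hu, Set.indicator_apply, mh', md, m₁, m₂, m12, if_false, sub_self]
        rw [this, norm_zero]
        exact add_nonneg hn₁ hn₂
  have hintu : ∫ w, u w = ((∫ w in D, g w) - (∫ w in upperHalfBall n, g w)) -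
      ((∫ w in D₁, g w) - (∫ w in D₂, g w)) := by
    have i1 := (integrable_indicator_iff hDm).2 (integrableOn_of_subset_splitCylinder hg
      (hDB.trans (splitBall_subset_splitCylinder n)))
    have i2 := (integrable_indicator_iff (measurableSet_upperHalfBall n)).2
      (integrableOn_of_subset_splitCylinder hg (upperHalfBall_subset_splitCylinder n))
    have i3 := (integrable_indicator_iff hD₁m).2 (integrableOn_of_subset_splitCylinder hg hD₁s)
    have i4 := (integrable_indicator_iff hD₂m).2 (integrableOn_of_subset_splitCylinder hg hD₂s)
    rw [show u = (D.indicator g - (upperHalfBall n).indicator g) -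
        (D₁.indicator g - D₂.indicator g) from rfl, integral_sub' (i1.sub i2) (i3.sub i4),
      integral_sub' i1 i2, integral_sub' i3 i4,
      integral_indicator hDm, integral_indicator (measurableSet_upperHalfBall n),
      integral_indicator hD₁m, integral_indicator hD₂m]
  have hbound : |∫ w, u w| ≤ M * (2 * (K * ε ^ 2) * W) + M * (n * (R * ε) * W * (2 * (R * ε))) := by
    have j1 : Integrable (S₁.indicator fun _ => M) :=
      (integrable_indicator_iff hS₁m).2 (integrableOn_const hS₁f)
    have j2 : Integrable (S₂.indicator fun _ => M) :=
      (integrable_indicator_iff hS₂m).2 (integrableOn_const hS₂f)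
    refine (norm_integral_le_of_norm_le (j1.add j2) (ae_of_all _ hub)).trans ?_
    rw [integral_add' j1 j2, integral_indicator_const _ hS₁m, integral_indicator_const _ hS₂m,
      smul_eq_mul, smul_eq_mul, mul_comm _ M, mul_comm _ M]
    exact add_le_add (mul_le_mul_of_nonneg_left hS₁r hM0) (mul_le_mul_of_nonneg_left hS₂v hM0)
  -- to first order in `ε` the difference of the two cylinder parts is the flux term
  have hflux : |(∫ w in D₁, g w) - (∫ w in D₂, g w) + ε * ∫ y in unitBall n, g (y, 0) * q y| ≤
      L * (Q * ε) ^ 2 * W := by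
    rw [hI₁, hI₂, ← integral_sub hi₁ hi₂, ← integral_const_mul,
      ← integral_add (f := fun y => (∫ z in (ε * q y)..1, g (y, z)) - ∫ z in (0 : ℝ)..1, g (y, z))
        (g := fun y => ε * (g (y, 0) * q y)) (hi₁.sub hi₂) (integrableOn_unitBall (by fun_prop))]
    rw [← Real.norm_eq_abs]
    refine norm_setIntegral_le_of_norm_le_const
      (measure_closedBall_lt_top : volume (unitBall n) < ⊤) fun y hy => ?_
    have hgy : ∀ a b : ℝ, IntervalIntegrable (fun z => g (y, z)) volume a b := fun a b =>
      Continuous.intervalIntegrable (by fun_prop) a b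
    have h1 : (∫ z in (ε * q y)..1, g (y, z)) - (∫ z in (0 : ℝ)..1, g (y, z)) +
        ε * (g (y, 0) * q y) = - ∫ z in (0 : ℝ)..(ε * q y), (g (y, z) - g (y, 0)) := by
      rw [intervalIntegral.integral_sub (hgy _ _) (by simp), intervalIntegral.integral_const,
        ← intervalIntegral.integral_add_adjacent_intervals (hgy 0 (ε * q y)) (hgy (ε * q y) 1)]
      simp only [sub_zero, smul_eq_mul]
      ring
    rw [h1, norm_neg]
    have hq1 := hεq y hy
    refine (intervalIntegral.norm_integral_le_of_norm_le_const (C := L * (Q * ε)) ?_).trans ?_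
    · intro z hz
      have hz' : |z| ≤ |ε * q y| := by
        rcases Set.mem_uIoc.1 hz with h | h
        · rw [abs_of_pos h.1, abs_of_pos (h.1.trans_le h.2)]; exact h.2
        · rw [abs_of_nonpos h.2, abs_of_neg (h.1.trans_le h.2)]; linarith [h.1]
      exact (hL y hy z (hz'.trans (hεq1 y hy))).trans
        (mul_le_mul_of_nonneg_left (hz'.trans hq1) hL0)
    · rw [sub_zero, sq, ← mul_assoc L (Q * ε)]
      exact mul_le_mul_of_nonneg_left hq1 (by positivity)
  have hfin := (abs_add_le (∫ w, u w)
    ((∫ w in D₁, g w) - (∫ w in D₂, g w) + ε * ∫ y in unitBall n, g (y, 0) * q y)).trans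
    (add_le_add hbound hflux)
  rw [hintu] at hfin
  refine le_of_eq_of_le ?_ (hfin.trans_eq (by ring))
  congr 1
  ring

/-! ### Splitting along the normal, and moments of the half-ball -/

/-- The volume-preserving coordinates `ℝⁿ⁺¹ ≃ ℝⁿ × ℝ` given by an orthonormal basis; the second
factor is the coordinate along the last basis vector. -/
noncomputable def splitEquiv {n : ℕ}
    (b : OrthonormalBasis (Fin (n + 1)) ℝ (EuclideanSpace ℝ (Fin (n + 1)))) :
    EuclideanSpace ℝ (Fin (n + 1)) ≃ᵐ EuclideanSpace ℝ (Fin n) × ℝ :=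
  (((b.measurableEquiv.trans (MeasurableEquiv.toLp 2 (Fin (n + 1) → ℝ)).symm).trans
    (MeasurableEquiv.piFinSuccAbove (fun _ => ℝ) (Fin.last n))).trans
      MeasurableEquiv.prodComm).trans
        (MeasurableEquiv.prodCongr (MeasurableEquiv.toLp 2 (Fin n → ℝ)) (MeasurableEquiv.refl ℝ))

section

variable {n : ℕ} (b : OrthonormalBasis (Fin (n + 1)) ℝ (EuclideanSpace ℝ (Fin (n + 1))))

lemma splitEquiv_fst (x : EuclideanSpace ℝ (Fin (n + 1))) (j : Fin n) :
    (splitEquiv b x).1 j = inner ℝ (b j.castSucc) x := by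
  rw [← b.repr_apply_apply, ← Fin.succAbove_last_apply]
  rfl

lemma splitEquiv_snd (x : EuclideanSpace ℝ (Fin (n + 1))) :
    (splitEquiv b x).2 = inner ℝ (b (Fin.last n)) x := by
  rw [← b.repr_apply_apply]
  rfl

lemma measurePreserving_splitEquiv : MeasurePreserving (splitEquiv b) :=
  (((b.measurePreserving_measurableEquiv.trans
    (EuclideanSpace.volume_preserving_symm_measurableEquiv_toLp _)).trans
      (volume_preserving_piFinSuccAbove (fun _ => ℝ) (Fin.last n))).trans
        Measure.measurePreserving_swap).trans
          ((PiLp.volume_preserving_toLp (Fin n)).prod (MeasurePreserving.id volume))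

lemma norm_splitEquiv (x : EuclideanSpace ℝ (Fin (n + 1))) :
    ‖(splitEquiv b x).1‖ ^ 2 + (splitEquiv b x).2 ^ 2 = ‖x‖ ^ 2 := by
  rw [EuclideanSpace.real_norm_sq_eq, ← b.sum_sq_norm_inner_right x, Fin.sum_univ_castSucc]
  simp [splitEquiv_fst, splitEquiv_snd]

lemma splitEquiv_preimage_splitBall : splitEquiv b ⁻¹' splitBall n = unitBall (n + 1) := by
  ext x
  rw [Set.mem_preimage, mem_closedBall_zero_iff]
  change ‖(splitEquiv b x).1‖ ^ 2 + (splitEquiv b x).2 ^ 2 ≤ 1 ↔ _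
  rw [norm_splitEquiv, sq_le_one_iff₀ (norm_nonneg x)]

lemma splitEquiv_smul (c : ℝ) (x : EuclideanSpace ℝ (Fin (n + 1))) :
    splitEquiv b (c • x) = c • splitEquiv b x := by
  refine Prod.ext ?_ ?_
  · ext j
    simp [splitEquiv_fst, inner_smul_right]
  · simp [splitEquiv_snd, inner_smul_right]

end

lemma setIntegral_splitBall {n : ℕ}
    (b : OrthonormalBasis (Fin (n + 1)) ℝ (EuclideanSpace ℝ (Fin (n + 1))))
    (g : EuclideanSpace ℝ (Fin n) × ℝ → ℝ) :
    ∫ w in splitBall n, g w = ∫ x in unitBall (n + 1), g (splitEquiv b x) := by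
  rw [← splitEquiv_preimage_splitBall b]
  exact ((measurePreserving_splitEquiv b).setIntegral_preimage_emb
    (splitEquiv b).measurableEmbedding g _).symm

/-- The integral of an even function over the half-ball is half of that over the ball. -/
lemma setIntegral_upperHalfBall_of_even {n : ℕ} {g : EuclideanSpace ℝ (Fin n) × ℝ → ℝ}
    (hg : Continuous g) (heven : ∀ w, g (-w) = g w) :
    ∫ w in upperHalfBall n, g w = (∫ w in splitBall n, g w) / 2 := by
  set Z := {w : EuclideanSpace ℝ (Fin n) × ℝ | w.2 = 0} with hZ
  have hZ0 : volume Z = 0 := by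
    have : Z = Set.univ ×ˢ {0} := by ext w; simp [hZ]
    rw [this, Measure.volume_eq_prod, Measure.prod_prod, Real.volume_singleton, mul_zero]
  set A := {w ∈ splitBall n | w.2 < 0} with hA
  have hAm : MeasurableSet A :=
    (isClosed_splitBall n).measurableSet.inter (measurableSet_lt measurable_snd measurable_const)
  have hAU : ∫ w in A, g w = ∫ w in upperHalfBall n, g w := by
    have hmp : MeasurePreserving (fun w : EuclideanSpace ℝ (Fin n) × ℝ => -w) :=
      (Measure.measurePreserving_neg (volume : Measure (EuclideanSpace ℝ (Fin n)))).prod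
        (Measure.measurePreserving_neg (volume : Measure ℝ))
    have h := hmp.setIntegral_preimage_emb (MeasurableEquiv.neg _).measurableEmbedding g (upperHalfBall n)
    have h2 : (fun w : EuclideanSpace ℝ (Fin n) × ℝ => -w) ⁻¹' upperHalfBall n = A := by
      ext w
      simp [upperHalfBall, splitBall, hA]
    simp only [heven] at h
    rw [← h, ← h2]
  have hsplit : ∫ w in splitBall n, g w = ∫ w in upperHalfBall n ∪ A, g w := by
    refine setIntegral_congr_set ?_
    have hz : ∀ᵐ w : EuclideanSpace ℝ (Fin n) × ℝ, w ∉ Z := measure_eq_zero_iff_ae_notMem.1 hZ0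
    filter_upwards [hz] with w hw
    have hw : w.2 ≠ 0 := hw
    apply propext
    change w ∈ splitBall n ↔ (w ∈ splitBall n ∧ 0 < w.2) ∨ (w ∈ splitBall n ∧ w.2 < 0)
    rcases lt_or_gt_of_ne hw with h | h <;> have := h.not_gt <;> tauto
  rw [hsplit, setIntegral_union, hAU]
  · ring
  · rw [Set.disjoint_left]
    intro w h1 h2
    exact lt_asymm h1.2 h2.2
  · exact hAm
  · exact integrableOn_of_subset_splitCylinder hg (upperHalfBall_subset_splitCylinder n)
  · exact integrableOn_of_subset_splitCylinder hg fun w h =>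
      splitBall_subset_splitCylinder n h.1

/-- Functions odd in the horizontal variable integrate to zero over the half-ball. -/
lemma setIntegral_upperHalfBall_eq_zero {n : ℕ} {g : EuclideanSpace ℝ (Fin n) × ℝ → ℝ}
    (hodd : ∀ y z, g (-y, z) = -g (y, z)) :
    ∫ w in upperHalfBall n, g w = 0 := by
  have hmp : MeasurePreserving (Prod.map Neg.neg id :
      EuclideanSpace ℝ (Fin n) × ℝ → EuclideanSpace ℝ (Fin n) × ℝ) :=
    (Measure.measurePreserving_neg (volume : Measure (EuclideanSpace ℝ (Fin n)))).prod
      (MeasurePreserving.id (volume : Measure ℝ))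
  have hemb : MeasurableEmbedding (Prod.map Neg.neg id :
      EuclideanSpace ℝ (Fin n) × ℝ → EuclideanSpace ℝ (Fin n) × ℝ) :=
    (MeasurableEquiv.prodCongr (MeasurableEquiv.neg _) (MeasurableEquiv.refl ℝ)).measurableEmbedding
  have h := hmp.setIntegral_preimage_emb hemb g (upperHalfBall n)
  have h2 : (Prod.map Neg.neg id : EuclideanSpace ℝ (Fin n) × ℝ → EuclideanSpace ℝ (Fin n) × ℝ) ⁻¹'
      upperHalfBall n = upperHalfBall n := by
    ext w
    simp [upperHalfBall, splitBall]
  rw [h2] at h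
  have h3 : ∀ w : EuclideanSpace ℝ (Fin n) × ℝ, g (Prod.map Neg.neg id w) = -g w :=
    fun w => hodd w.1 w.2
  simp only [h3, integral_neg] at h
  linarith

lemma setIntegral_upperHalfBall_one (n : ℕ) :
    ∫ _ in upperHalfBall n, (1 : ℝ) = ballVolume (n + 1) 1 / 2 := by
  rw [setIntegral_upperHalfBall_of_even continuous_const fun _ => rfl,
    setIntegral_splitBall (EuclideanSpace.basisFun _ ℝ)]
  simp [ballVolume]

lemma setIntegral_upperHalfBall_fst (n : ℕ) (i : Fin n) :
    ∫ w in upperHalfBall n, w.1 i = 0 :=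
  setIntegral_upperHalfBall_eq_zero fun _ _ => by simp

lemma setIntegral_upperHalfBall_fst_mul_snd (n : ℕ) (i : Fin n) :
    ∫ w in upperHalfBall n, w.1 i * w.2 = 0 :=
  setIntegral_upperHalfBall_eq_zero fun _ _ => by simp

lemma setIntegral_upperHalfBall_fst_mul_fst (n : ℕ) (i j : Fin n) :
    ∫ w in upperHalfBall n, w.1 i * w.1 j =
      if i = j then ballVolume (n + 1) 1 / (2 * (n + 3)) else 0 := by
  rw [setIntegral_upperHalfBall_of_even (by fun_prop) (by simp),
    setIntegral_splitBall (EuclideanSpace.basisFun _ ℝ)]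
  simp only [splitEquiv_fst, EuclideanSpace.basisFun_inner]
  rw [setIntegral_unitBall_mul]
  simp only [Fin.castSucc_inj]
  split_ifs
  · push_cast; rw [div_div]; congr 1; ring
  · simp

lemma setIntegral_upperHalfBall_snd_sq (n : ℕ) :
    ∫ w in upperHalfBall n, w.2 ^ 2 = ballVolume (n + 1) 1 / (2 * (n + 3)) := by
  rw [setIntegral_upperHalfBall_of_even (by fun_prop) (by simp),
    setIntegral_splitBall (EuclideanSpace.basisFun _ ℝ)]
  simp only [splitEquiv_snd, EuclideanSpace.basisFun_inner]
  rw [setIntegral_unitBall_sq]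
  push_cast; rw [div_div]; congr 1; ring

lemma setIntegral_upperHalfBall_snd (n : ℕ) :
    ∫ w in upperHalfBall n, w.2 = ballVolume n 1 / (n + 2) := by
  have hint : Integrable ((upperHalfBall n).indicator fun w => w.2) (volume.prod volume) :=
    (integrable_indicator_iff (measurableSet_upperHalfBall n)).2
      (integrableOn_of_subset_splitCylinder continuous_snd (upperHalfBall_subset_splitCylinder n))
  have hin : ∀ y : EuclideanSpace ℝ (Fin n),
      ∫ z, (upperHalfBall n).indicator (fun w => w.2) (y, z) =
      (unitBall n).indicator (fun y => (1 - ‖y‖ ^ 2) / 2) y := by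
    intro y
    by_cases hy : y ∈ unitBall n
    · rw [Set.indicator_of_mem hy]
      have hy1 : 0 ≤ 1 - ‖y‖ ^ 2 := by
        rw [mem_closedBall_zero_iff] at hy
        nlinarith [norm_nonneg y]
      have h1 : ∀ z, (upperHalfBall n).indicator (fun w => w.2) (y, z) =
          (Set.Ioc 0 (√(1 - ‖y‖ ^ 2))).indicator (fun z => z) z := fun z => by
        have : (y, z) ∈ upperHalfBall n ↔ z ∈ Set.Ioc 0 (√(1 - ‖y‖ ^ 2)) := by
          change ‖y‖ ^ 2 + z ^ 2 ≤ 1 ∧ 0 < z ↔ 0 < z ∧ z ≤ √(1 - ‖y‖ ^ 2)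
          rw [and_comm]
          refine and_congr_right fun hz => ?_
          rw [Real.le_sqrt hz.le hy1]
          constructor <;> intro <;> linarith
        classical
        simp only [Set.indicator_apply, this]
      simp only [h1]
      rw [integral_indicator measurableSet_Ioc, ← intervalIntegral.integral_of_le (Real.sqrt_nonneg _),
        integral_id, Real.sq_sqrt hy1]
      ring
    · rw [Set.indicator_of_notMem hy]
      have : ∀ z, (upperHalfBall n).indicator (fun w => w.2) (y, z) = 0 := fun z => by
        have h : (y, z) ∉ upperHalfBall n := fun h => by
          have h2 := upperHalfBall_subset_splitCylinder n h
          rw [splitCylinder, Set.mem_prod] at h2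
          exact hy h2.1
        exact Set.indicator_of_notMem h _
      simp [this]
  rw [← integral_indicator (measurableSet_upperHalfBall n), Measure.volume_eq_prod,
    integral_prod _ hint]
  simp only [hin]
  have i1 : IntegrableOn (fun _ : EuclideanSpace ℝ (Fin n) => (1 : ℝ)) (unitBall n) :=
    integrableOn_unitBall continuous_const
  have i2 : IntegrableOn (fun y : EuclideanSpace ℝ (Fin n) => ‖y‖ ^ 2) (unitBall n) :=
    integrableOn_unitBall (by fun_prop)
  have h3 : ∫ y in unitBall n, (1 - ‖y‖ ^ 2) = ballVolume n 1 - n / (n + 2) * ballVolume n 1 := by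
    have h4 := setIntegral_unitBall_norm_pow (d := n) 2 (by norm_num)
    rw [integral_sub i1 i2, h4]
    simp [ballVolume]
  rw [integral_indicator measurableSet_closedBall, integral_div, h3]
  field_simp
  ring

/-! ### Taylor estimates -/

section Taylor

variable {E F : Type*} [NormedAddCommGroup E] [NormedSpace ℝ E] [NormedAddCommGroup F]
  [NormedSpace ℝ F]

lemma ContDiffAt.exists_bound_sub_fderiv {f : E → F} {p : E} (hf : ContDiffAt ℝ 2 f p) :
    ∃ r > 0, ∃ K : ℝ, 0 ≤ K ∧ ∀ x ∈ Metric.ball p r, ∀ y ∈ Metric.ball p r,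
      ‖f y - f x - fderiv ℝ f x (y - x)‖ ≤ K * ‖y - x‖ ^ 2 := by
  have h1 : ContDiffAt ℝ 1 (fderiv ℝ f) p := hf.fderiv_right (by norm_num)
  obtain ⟨K, t, ht, hK⟩ := h1.exists_lipschitzOnWith
  have h2 : ∀ᶠ x in 𝓝 p, DifferentiableAt ℝ f x :=
    (hf.eventually (by simp)).mono fun x hx => hx.differentiableAt (by norm_num)
  obtain ⟨r, hr, hball⟩ := Metric.eventually_nhds_iff_ball.1 (h2.and ht)
  refine ⟨r, hr, K, K.2, fun x hx y hy => ?_⟩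
  -- on this convex set the derivative differs from `fderiv ℝ f x` by at most `K * ‖y - x‖`
  have hconv : Convex ℝ (Metric.ball p r ∩ Metric.closedBall x ‖y - x‖) :=
    (convex_ball _ _).inter (convex_closedBall _ _)
  have := hconv.norm_image_sub_le_of_norm_fderiv_le' (f := f) (φ := fderiv ℝ f x)
    (C := K * ‖y - x‖) (fun z hz => (hball z hz.1).1) (fun z hz => ?_)
    ⟨hx, by simp⟩ ⟨hy, by simp [dist_eq_norm]⟩
  · rwa [mul_assoc, ← sq] at this
  · refine (hK.norm_sub_le (hball z hz.1).2 (hball x hx).2).trans ?_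
    exact mul_le_mul_of_nonneg_left (by simpa [dist_eq_norm] using hz.2) K.2

/-- The second-order Taylor estimate, obtained from the first-order one for the derivative by the
mean value inequality. -/
lemma ContDiffAt.exists_bound_sub_second_order {f : E → ℝ} {p : E} (hf : ContDiffAt ℝ 3 f p) :
    ∃ r > 0, ∃ K : ℝ, 0 ≤ K ∧ ∀ x ∈ Metric.ball p r,
      |f x - f p - fderiv ℝ f p (x - p) - fderiv ℝ (fderiv ℝ f) p (x - p) (x - p) / 2| ≤
        K * ‖x - p‖ ^ 3 := by
  have h1 : ContDiffAt ℝ 2 (fderiv ℝ f) p := hf.fderiv_right (by norm_num)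
  obtain ⟨r₁, hr₁, K, hK0, hK⟩ := h1.exists_bound_sub_fderiv
  have h2 : ∀ᶠ x in 𝓝 p, DifferentiableAt ℝ f x :=
    (hf.eventually (by simp)).mono fun x hx => hx.differentiableAt (by norm_num)
  obtain ⟨r₂, hr₂, hball⟩ := Metric.eventually_nhds_iff_ball.1 h2
  have hsymm : IsSymmSndFDerivAt ℝ f p := hf.isSymmSndFDerivAt (by simp; norm_cast)
  refine ⟨min r₁ r₂, lt_min hr₁ hr₂, K, hK0, fun x hx => ?_⟩
  set B := fderiv ℝ (fderiv ℝ f) p with hB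
  have hconv : Convex ℝ (Metric.ball p (min r₁ r₂) ∩ Metric.closedBall p ‖x - p‖) :=
    (convex_ball _ _).inter (convex_closedBall _ _)
  have hp : p ∈ Metric.ball p r₁ := Metric.mem_ball_self hr₁
  have hder : ∀ z ∈ Metric.ball p (min r₁ r₂) ∩ Metric.closedBall p ‖x - p‖,
      HasFDerivWithinAt (fun z => f z - fderiv ℝ f p (z - p) - B (z - p) (z - p) / 2)
        (fderiv ℝ f z - fderiv ℝ f p - B (z - p))
        (Metric.ball p (min r₁ r₂) ∩ Metric.closedBall p ‖x - p‖) z := by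
    intro z hz
    have hz2 : z ∈ Metric.ball p r₂ := Metric.ball_subset_ball (min_le_right _ _) hz.1
    have e0 : HasFDerivAt (fun z : E => z - p) (ContinuousLinearMap.id ℝ E) z :=
      (hasFDerivAt_id z).sub_const p
    have e1 := (hball z hz2).hasFDerivAt
    have e2 : HasFDerivAt (fun z => fderiv ℝ f p (z - p)) (fderiv ℝ f p) z :=
      (fderiv ℝ f p).hasFDerivAt.comp z e0
    have e3 : HasFDerivAt (fun z => B (z - p)) B z := B.hasFDerivAt.comp z e0
    have e4 := (e3.clm_apply e0).mul_const (1 / 2 : ℝ)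
    have e5 := (e1.sub e2).sub e4
    refine (e5.congr_fderiv ?_).hasFDerivWithinAt.congr (fun w _ => ?_) ?_
    · ext v
      have := hsymm.eq v (z - p)
      simp only [sub_apply, add_apply,
        smul_apply, ContinuousLinearMap.comp_apply,
        ContinuousLinearMap.flip_apply, ContinuousLinearMap.id_apply, smul_eq_mul, ← hB] at this ⊢
      rw [this]; ring
    · simp; ring
    · simp; ring
  have := hconv.norm_image_sub_le_of_norm_hasFDerivWithin_le hder (C := K * ‖x - p‖ ^ 2)
    (fun z hz => ?_) (x := p) (y := x) ⟨Metric.mem_ball_self (lt_min hr₁ hr₂), by simp⟩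
    ⟨hx, by simp [dist_eq_norm]⟩
  · rw [Real.norm_eq_abs] at this
    convert this using 1
    · congr 1; simp; ring
    · ring
  · have hz1 : z ∈ Metric.ball p r₁ := Metric.ball_subset_ball (min_le_left _ _) hz.1
    refine (hK p hp z hz1).trans (mul_le_mul_of_nonneg_left ?_ hK0)
    exact pow_le_pow_left₀ (norm_nonneg _) (by simpa [dist_eq_norm] using hz.2) 2

end Taylor

/-! ### The second fundamental form of a level set -/

section LevelSet

variable {n : ℕ} {S : Set (EuclideanSpace ℝ (Fin (n + 1)))}
  {N : EuclideanSpace ℝ (Fin (n + 1)) → EuclideanSpace ℝ (Fin (n + 1))}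
  {U : Set (EuclideanSpace ℝ (Fin (n + 1)))} {f : EuclideanSpace ℝ (Fin (n + 1)) → ℝ}

/-- Every vector in the kernel of the differential is the velocity of a curve in the level set, by
the implicit function theorem. -/
lemma mem_tangentVectorsAt_of_fderiv_eq_zero (hU : IsOpen U)
    (hfU : ContDiffOn ℝ ∞ f U) (hf' : ∀ x ∈ U, fderiv ℝ f x ≠ 0)
    (hS : S ∩ U = {x ∈ U | f x = 0})
    {q : EuclideanSpace ℝ (Fin (n + 1))} (hq : q ∈ S ∩ U) {v : EuclideanSpace ℝ (Fin (n + 1))}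
    (hv : fderiv ℝ f q v = 0) : v ∈ tangentVectorsAt S q := by
  have hfq : f q = 0 := by rw [hS] at hq; exact hq.2
  have hqU : q ∈ U := hq.2
  have hst : HasStrictFDerivAt f (fderiv ℝ f q) q :=
    (hfU.contDiffAt (hU.mem_nhds hqU)).hasStrictFDerivAt (by simp)
  have hsurj : (fderiv ℝ f q).range = ⊤ := by
    have h0 := hf' q hqU
    rw [LinearMap.range_eq_top]
    apply LinearMap.surjective_of_ne_zero
    intro h
    exact h0 (ContinuousLinearMap.coe_injective h)
  set w : (fderiv ℝ f q).ker := ⟨v, hv⟩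
  set G := hst.implicitFunction f (fderiv ℝ f q) hsurj (f q) with hG
  have hG0 : G 0 = q := by
    simp [hG]
  have hGd : HasStrictFDerivAt G (fderiv ℝ f q).ker.subtypeL 0 := hst.to_implicitFunction hsurj
  have hline : HasDerivAt (fun t : ℝ => t • w) w 0 := by
    simpa using (hasDerivAt_id (0 : ℝ)).smul_const w
  have hcurve : HasDerivAt (fun t : ℝ => G (t • w)) v 0 := by
    have : HasFDerivAt G (fderiv ℝ f q).ker.subtypeL ((0 : ℝ) • w) := by
      rw [zero_smul]; exact hGd.hasFDerivAt
    exact this.comp_hasDerivAt (0 : ℝ) hline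
  refine ⟨fun t => G (t • w), by simp [hG0], ?_, hcurve⟩
  have hmap := hst.map_implicitFunction_eq hsurj
  have htend : Tendsto (fun t : ℝ => (f q, t • w)) (𝓝 0) (𝓝 (f q, 0)) := by
    have : ContinuousAt (fun t : ℝ => (f q, t • w)) 0 := by fun_prop
    simpa [ContinuousAt] using this
  have hU' : ∀ᶠ t in 𝓝 (0 : ℝ), G (t • w) ∈ U :=
    hcurve.continuousAt.eventually_mem (by simpa [hG0] using hU.mem_nhds hqU)
  filter_upwards [htend.eventually hmap, hU'] with t h1 h2
  have : G (t • w) ∈ S ∩ U := by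
    rw [hS]
    exact ⟨h2, by rw [← hfq]; exact h1⟩
  exact this.1

/-- Along the level set the differential is a multiple of the pairing with the unit normal: the
vector `df(N) w - df(w) N` lies in the kernel of `df`, hence is tangent and orthogonal to `N`. -/
lemma fderiv_normal_mul_inner (hU : IsOpen U)
    (hfU : ContDiffOn ℝ ∞ f U) (hf' : ∀ x ∈ U, fderiv ℝ f x ≠ 0)
    (hS : S ∩ U = {x ∈ U | f x = 0})
    {q : EuclideanSpace ℝ (Fin (n + 1))} (hq : q ∈ S ∩ U)
    (hN1 : ‖N q‖ = 1) (hN : ∀ v ∈ tangentVectorsAt S q, inner ℝ v (N q) = 0)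
    (w : EuclideanSpace ℝ (Fin (n + 1))) :
    fderiv ℝ f q w = fderiv ℝ f q (N q) * inner ℝ w (N q) := by
  have h1 := hN (fderiv ℝ f q (N q) • w - fderiv ℝ f q w • N q)
    (mem_tangentVectorsAt_of_fderiv_eq_zero hU hfU hf' hS hq (by simp [mul_comm]))
  rw [inner_sub_left, inner_smul_left, inner_smul_left, real_inner_self_eq_norm_sq, hN1] at h1
  simp only [RCLike.conj_to_real] at h1
  linarith

/-- The Hessian of a defining function restricted to the tangent space is, up to the
factor `-df(N)`, the second fundamental form. This is the derivative of
`df(w) = df(N) ⟪w, N⟫` along a curve in the level set. -/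
lemma fderiv_fderiv_tangent (hU : IsOpen U) (hfU : ContDiffOn ℝ ∞ f U)
    (hf' : ∀ x ∈ U, fderiv ℝ f x ≠ 0) (hS : S ∩ U = {x ∈ U | f x = 0})
    {p : EuclideanSpace ℝ (Fin (n + 1))} (hp : p ∈ S ∩ U) (hN : IsUnitNormalFieldAround S N p)
    {v w : EuclideanSpace ℝ (Fin (n + 1))} (hv : v ∈ tangentVectorsAt S p)
    (hw : w ∈ tangentVectorsAt S p) :
    fderiv ℝ (fderiv ℝ f) p v w = -(fderiv ℝ f p (N p) * inner ℝ w (weingartenMap N p v)) := by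
  obtain ⟨V, hV, hpV, hNV, hNS⟩ := hN
  have hwN : inner ℝ w (N p) = 0 := (hNS p ⟨hp.1, hpV⟩).2 w hw
  obtain ⟨γ, h0, hγS, hγ⟩ := hv
  have hγU : ∀ᶠ t in 𝓝 (0 : ℝ), γ t ∈ U :=
    hγ.continuousAt.eventually_mem (by rw [h0]; exact hU.mem_nhds hp.2)
  have hγV : ∀ᶠ t in 𝓝 (0 : ℝ), γ t ∈ V :=
    hγ.continuousAt.eventually_mem (by rw [h0]; exact hV.mem_nhds hpV)
  have hfd : HasFDerivAt (fderiv ℝ f) (fderiv ℝ (fderiv ℝ f) p) (γ 0) := by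
    rw [h0]
    have : ContDiffAt ℝ 1 (fderiv ℝ f) p :=
      (hfU.contDiffAt (hU.mem_nhds hp.2)).fderiv_right (by norm_cast)
    exact (this.differentiableAt (by simp)).hasFDerivAt
  have hNd : HasFDerivAt N (fderiv ℝ N p) (γ 0) := by
    rw [h0]
    exact ((hNV.contDiffAt (hV.mem_nhds hpV)).differentiableAt (by simp)).hasFDerivAt
  have hA : HasDerivAt (fun t => fderiv ℝ f (γ t)) (fderiv ℝ (fderiv ℝ f) p v) 0 :=
    hfd.comp_hasDerivAt 0 hγ
  have hB : HasDerivAt (fun t => N (γ t)) (fderiv ℝ N p v) 0 := hNd.comp_hasDerivAt 0 hγ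
  have hL : HasDerivAt (fun t => fderiv ℝ f (γ t) w) (fderiv ℝ (fderiv ℝ f) p v w) 0 := by
    simpa using hA.clm_apply (hasDerivAt_const (0 : ℝ) w)
  have hR1 := hA.clm_apply hB
  have hR2 : HasDerivAt (fun t => inner ℝ w (N (γ t))) (inner ℝ w (fderiv ℝ N p v)) 0 := by
    simpa using (hasDerivAt_const (0 : ℝ) w).inner ℝ hB
  have hR := hR1.mul hR2
  have heq : (fun t => fderiv ℝ f (γ t) w) =ᶠ[𝓝 0]
      fun t => fderiv ℝ f (γ t) (N (γ t)) * inner ℝ w (N (γ t)) := by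
    filter_upwards [hγS, hγU, hγV] with t h1 h2 h3
    obtain ⟨h4, h5⟩ := hNS (γ t) ⟨h1, h3⟩
    exact fderiv_normal_mul_inner hU hfU hf' hS ⟨h1, h2⟩ h4 h5 w
  have := (hL.congr_of_eventuallyEq heq.symm).unique hR
  rw [this, h0, hwN, weingartenMap, inner_neg_right]
  ring

end LevelSet

/-! ### Local description of the spherical component -/

section Region

variable {n : ℕ} {S : Set (EuclideanSpace ℝ (Fin (n + 1)))}
  {N : EuclideanSpace ℝ (Fin (n + 1)) → EuclideanSpace ℝ (Fin (n + 1))}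
  {f : EuclideanSpace ℝ (Fin (n + 1)) → ℝ} {p : EuclideanSpace ℝ (Fin (n + 1))}

/-- In small balls, the positivity region of a defining function is connected, and hence is the
spherical component: it is star-shaped about a point on the normal at half the radius, because
along segments the function is concave up to an error of second order. -/
lemma sphericalComponent_eq_pos {U : Set (EuclideanSpace ℝ (Fin (n + 1)))} (hU : IsOpen U)
    (hpU : p ∈ U) (hfc : ContinuousOn f U) (hf2 : ContDiffAt ℝ 2 f p)
    (hS : S ∩ U = {x ∈ U | f x = 0}) (hpS : p ∈ S) (hN : ‖N p‖ = 1)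
    (hpos : 0 < fderiv ℝ f p (N p)) :
    ∃ r > 0, ∀ ε, 0 < ε → ε < r →
      sphericalComponent S N p ε = {x ∈ Metric.closedBall p ε | 0 < f x} := by
  obtain ⟨r₁, hr₁, K, hK0, hK⟩ := hf2.exists_bound_sub_fderiv
  obtain ⟨r₂, hr₂, hr₂U⟩ := Metric.isOpen_iff.1 hU p hpU
  set c := fderiv ℝ f p (N p) with hc
  have hfp : f p = 0 := by
    have : p ∈ S ∩ U := ⟨hpS, hpU⟩
    rw [hS] at this; exact this.2
  refine ⟨min (min r₁ r₂) (c / (10 * K + 1)), by positivity, fun ε hε hεr => ?_⟩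
  have hε1 : ε < r₁ := hεr.trans_le ((min_le_left _ _).trans (min_le_left _ _))
  have hε2 : ε < r₂ := hεr.trans_le ((min_le_left _ _).trans (min_le_right _ _))
  have hε3 : ε * (10 * K + 1) < c := by
    rw [← lt_div_iff₀ (by positivity)]; exact hεr.trans_le (min_le_right _ _)
  have hB1 : Metric.closedBall p ε ⊆ Metric.ball p r₁ := Metric.closedBall_subset_ball hε1
  have hBU : Metric.closedBall p ε ⊆ U := (Metric.closedBall_subset_ball hε2).trans hr₂U
  have hpB : p ∈ Metric.ball p r₁ := Metric.mem_ball_self hr₁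
  set D := {x ∈ Metric.closedBall p ε | 0 < f x} with hD
  have hline : ∀ t, 0 ≤ t → t ≤ ε → p + t • N p ∈ Metric.closedBall p ε ∧
      c * t - K * t ^ 2 ≤ f (p + t • N p) := by
    intro t ht htε
    have hm : p + t • N p ∈ Metric.closedBall p ε := by
      simp [norm_smul, hN, abs_of_nonneg ht, htε]
    refine ⟨hm, ?_⟩
    have := hK p hpB _ (hB1 hm)
    rw [add_sub_cancel_left, map_smul, norm_smul, hN, hfp, Real.norm_eq_abs, Real.norm_eq_abs,
      abs_of_nonneg ht, smul_eq_mul, ← hc] at this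
    have := (abs_le.1 this).1
    linarith
  have hev : ∀ᶠ t in 𝓝[>] (0 : ℝ), p + t • N p ∈ D := by
    filter_upwards [Ioo_mem_nhdsGT hε] with t ht
    obtain ⟨h1, h2⟩ := hline t ht.1.le ht.2.le
    refine ⟨h1, lt_of_lt_of_le ?_ h2⟩
    have h3 : K * t ≤ K * ε := mul_le_mul_of_nonneg_left ht.2.le hK0
    have h4 : 0 ≤ K * ε := by positivity
    have h5 : 0 < t * (c - K * t) := mul_pos ht.1 (by linarith)
    linarith
  set m := p + (ε / 2) • N p with hm
  obtain ⟨hmB, hmf⟩ := hline (ε / 2) (by positivity) (by linarith)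
  rw [← hm] at hmB hmf
  have hKε : 0 ≤ K * ε := by positivity
  have hmD : m ∈ D := by
    refine ⟨hmB, lt_of_lt_of_le ?_ hmf⟩
    have : 0 < ε * (c / 2 - K * ε / 4) := mul_pos hε (by linarith)
    linarith
  have hstar : StarConvex ℝ m D := by
    intro x hx a s ha hs has
    have hyB : a • m + s • x ∈ Metric.closedBall p ε := convex_closedBall p ε hmB hx.1 ha hs has
    refine ⟨hyB, ?_⟩
    set y := a • m + s • x with hy
    have e1 : x - y = a • (x - m) := by
      rw [hy, show s = 1 - a by linarith]; module
    have e2 : m - y = -(s • (x - m)) := by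
      rw [hy, show a = 1 - s by linarith]; module
    have t1 := hK y (hB1 hyB) x (hB1 hx.1)
    have t2 := hK y (hB1 hyB) m (hB1 hmB)
    rw [e1, map_smul, norm_smul, Real.norm_eq_abs, Real.norm_eq_abs, abs_of_nonneg ha,
      smul_eq_mul] at t1
    rw [e2, map_neg, map_smul, norm_neg, norm_smul, Real.norm_eq_abs, Real.norm_eq_abs,
      abs_of_nonneg hs, smul_eq_mul] at t2
    have t1' := (abs_le.1 t1).2
    have t2' := (abs_le.1 t2).2
    have hd : ‖x - m‖ ≤ 2 * ε := by
      have := dist_triangle_right x m p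
      rw [dist_eq_norm] at this
      linarith [Metric.mem_closedBall.1 hx.1, Metric.mem_closedBall.1 hmB]
    have hd2 : ‖x - m‖ ^ 2 ≤ (2 * ε) ^ 2 := pow_le_pow_left₀ (norm_nonneg _) hd 2
    set δ := ‖x - m‖ ^ 2 with hδ
    -- the Taylor estimates at `y` towards the two end points; the linear terms cancel
    have hfy : s * f x + a * f m - K * (a * s * δ) ≤ f y := by
      have u1 := mul_le_mul_of_nonneg_left t1' hs
      have u2 := mul_le_mul_of_nonneg_left t2' ha
      have e3 : s * (K * (a * ‖x - m‖) ^ 2) + a * (K * (s * ‖x - m‖) ^ 2) = K * (a * s * δ) := by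
        rw [hδ]
        linear_combination (K * a * s * ‖x - m‖ ^ 2) * has
      have e4 : f y = (s + a) * f y := by rw [add_comm, has, one_mul]
      linarith
    rcases ha.eq_or_lt with h0 | h0
    · have : s = 1 := by linarith
      rw [← h0, this] at hfy
      linarith [hx.2]
    · have h1 : 0 ≤ s * f x := mul_nonneg hs hx.2.le
      have h2 : K * (a * s * δ) ≤ a * (K * (2 * ε) ^ 2) := by
        have : s * δ ≤ (2 * ε) ^ 2 := (mul_le_of_le_one_left (by positivity) (by linarith)).trans hd2
        have := mul_le_mul_of_nonneg_left this (mul_nonneg ha hK0)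
        linarith
      have h3 : 0 < a * (ε * (c / 2 - K * ε / 4 - 4 * (K * ε))) :=
        mul_pos h0 (mul_pos hε (by linarith))
      have h4 := mul_le_mul_of_nonneg_left hmf ha
      linarith
  have hDpre : IsPreconnected D := (hstar.isPathConnected hmD).isConnected.isPreconnected
  have hzero : ∀ x ∈ Metric.closedBall p ε, f x = 0 ↔ x ∈ S := fun x hx => by
    have : x ∈ S ∩ U ↔ x ∈ {x ∈ U | f x = 0} := by rw [hS]
    constructor
    · intro h; exact (this.2 ⟨hBU hx, h⟩).1
    · intro h; exact (this.1 ⟨h, hBU hx⟩).2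
  have hDsub : D ⊆ Metric.closedBall p ε \ S := fun x hx =>
    ⟨hx.1, fun h => hx.2.ne' ((hzero x hx.1).2 h)⟩
  ext x
  constructor
  · intro hx
    have hx' : ∀ᶠ t in 𝓝[>] (0 : ℝ), p + t • N p ∈
        connectedComponentIn (Metric.closedBall p ε \ S) x := hx
    obtain ⟨t, ht1, ht2⟩ := (hx'.and hev).exists
    have hxF : x ∈ Metric.closedBall p ε \ S := connectedComponentIn_nonempty_iff.1 ⟨_, ht1⟩
    refine ⟨hxF.1, ?_⟩
    by_contra hneg
    have hsub := connectedComponentIn_subset (Metric.closedBall p ε \ S) x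
    obtain ⟨z, hz, hfz⟩ := isPreconnected_connectedComponentIn.intermediate_value
      (mem_connectedComponentIn hxF) ht1
      (hfc.mono (hsub.trans (Set.sdiff_subset.trans hBU))) ⟨not_lt.1 hneg, ht2.2.le⟩
    exact (hsub hz).2 ((hzero z (hsub hz).1).1 hfz)
  · intro hx
    have := hDpre.subset_connectedComponentIn hx hDsub
    exact hev.mono fun t ht => this ht

/-- Second-order position of a level set: if, in an orthonormal frame, the differential of `f`
is `c` times the last coordinate and the tangential Hessian is `-c` times the diagonal form with
entries `κ`, then the zero set is the graph of `½ ∑ κ y²` up to third order. -/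
lemma exists_sign_of_second_order
    (b : OrthonormalBasis (Fin (n + 1)) ℝ (EuclideanSpace ℝ (Fin (n + 1)))) {κ : Fin n → ℝ}
    {c : ℝ} (hc : 0 < c) (hf : ContDiffAt ℝ 3 f p) (hfp : f p = 0)
    (h1 : ∀ w, fderiv ℝ f p w = c * inner ℝ (b (Fin.last n)) w)
    (h2 : ∀ i j : Fin n, fderiv ℝ (fderiv ℝ f) p (b i.castSucc) (b j.castSucc) =
      if i = j then -(c * κ i) else 0) :
    ∃ r > 0, ∃ K : ℝ, 0 ≤ K ∧ ∀ x ∈ Metric.ball p r,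
      ((∑ i, κ i * inner ℝ (b i.castSucc) (x - p) ^ 2) / 2 + K * ‖x - p‖ ^ 3 <
        inner ℝ (b (Fin.last n)) (x - p) → 0 < f x) ∧
      (inner ℝ (b (Fin.last n)) (x - p) <
        (∑ i, κ i * inner ℝ (b i.castSucc) (x - p) ^ 2) / 2 - K * ‖x - p‖ ^ 3 → f x < 0) := by
  obtain ⟨r, hr, K, hK0, hK⟩ := hf.exists_bound_sub_second_order
  have hsymm : IsSymmSndFDerivAt ℝ f p := hf.isSymmSndFDerivAt (by simp; norm_cast)
  set B := fderiv ℝ (fderiv ℝ f) p with hB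
  set Λ := 3 * ‖B‖ / c with hΛ
  set Q := ∑ i, |κ i| with hQ
  have hΛ0 : 0 ≤ Λ := by positivity
  have hQ0 : 0 ≤ Q := Finset.sum_nonneg fun i _ => abs_nonneg _
  refine ⟨min r (1 / (2 * Λ + 1)), by positivity, 2 * (Q * Λ + K / c), by positivity, ?_⟩
  intro x hx
  have hxr : x ∈ Metric.ball p r := Metric.ball_subset_ball (min_le_left _ _) hx
  have hxΛ : ‖x - p‖ * (2 * Λ + 1) < 1 := by
    rw [← lt_div_iff₀ (by positivity), ← dist_eq_norm]
    exact (Metric.mem_ball.1 hx).trans_le (min_le_right _ _)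
  have hT := hK x hxr
  set h := x - p with hh
  set ρ := ‖h‖ with hρ
  have hρ0 : 0 ≤ ρ := norm_nonneg _
  set ν := b (Fin.last n) with hν
  set z := inner ℝ ν h with hz
  set h' := ∑ i : Fin n, inner ℝ (b i.castSucc) h • b i.castSucc with hh'
  have hdec : h = h' + z • ν := by
    conv_lhs => rw [← b.sum_repr' h, Fin.sum_univ_castSucc]
  have hν1 : ‖ν‖ = 1 := b.orthonormal.1 _
  have hzρ : |z| ≤ ρ := by simpa [hν1] using abs_real_inner_le_norm ν h
  have hh'ρ : ‖h'‖ ≤ 2 * ρ := by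
    have : h' = h - z • ν := by rw [hdec]; simp
    rw [this]
    refine (norm_sub_le _ _).trans ?_
    rw [norm_smul, hν1, mul_one, Real.norm_eq_abs]
    linarith
  set q := (∑ i, κ i * inner ℝ (b i.castSucc) h ^ 2) / 2 with hq
  have hBt : B h' h' = -(2 * c * q) := by
    have e1 : B h' h' = ∑ i : Fin n, ∑ j : Fin n, inner ℝ (b i.castSucc) h *
        (inner ℝ (b j.castSucc) h * B (b i.castSucc) (b j.castSucc)) := by
      rw [hh']
      simp only [map_sum, map_smul, sum_apply, smul_apply,
        smul_eq_mul, Finset.mul_sum]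
      rw [Finset.sum_comm]
      refine Finset.sum_congr rfl fun i _ => Finset.sum_congr rfl fun j _ => by ring
    rw [e1]
    simp only [h2, mul_ite, mul_zero, Finset.sum_ite_eq, Finset.mem_univ, if_true]
    rw [hq, ← neg_mul, mul_div_assoc', mul_comm _ (∑ i, _), Finset.sum_mul, Finset.sum_div]
    exact Finset.sum_congr rfl fun i _ => by ring
  -- the relative error of replacing `f / c` by `z - q`; it vanishes at first order
  set l := (B h' ν + z * B ν ν / 2) / c with hl
  have hlρ : |l| ≤ Λ * ρ := by
    rw [hl, abs_div, abs_of_pos hc, hΛ, div_mul_eq_mul_div]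
    refine div_le_div_of_nonneg_right ?_ hc.le
    have b1 : |B h' ν| ≤ ‖B‖ * (2 * ρ) := by
      have := B.le_opNorm₂ h' ν
      rw [hν1, mul_one, Real.norm_eq_abs] at this
      exact this.trans (mul_le_mul_of_nonneg_left hh'ρ (norm_nonneg B))
    have b2 : |z * B ν ν / 2| ≤ ρ * ‖B‖ := by
      have := B.le_opNorm₂ ν ν
      rw [hν1, mul_one, mul_one, Real.norm_eq_abs] at this
      rw [abs_div, abs_mul, abs_two]
      have h3 := mul_le_mul hzρ this (abs_nonneg _) hρ0
      have h4 : 0 ≤ ρ * ‖B‖ := by positivity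
      linarith
    refine (abs_add_le _ _).trans ?_
    linarith
  have hquad : fderiv ℝ f p h + B h h / 2 = c * (z * (1 + l) - q) := by
    have e1 : B h h = B h' h' + 2 * z * B h' ν + z ^ 2 * B ν ν := by
      have := hsymm.eq ν h'
      rw [← hB] at this
      conv_lhs => rw [hdec]
      simp only [map_add, map_smul, add_apply, smul_apply, smul_eq_mul, this]
      ring
    have e2 : c * l = B h' ν + z * B ν ν / 2 := by
      rw [hl]; field_simp
    rw [e1, hBt, h1, mul_sub, mul_add, mul_one, mul_add, mul_left_comm, e2]
    ring
  rw [hfp, sub_zero, sub_sub, hquad] at hT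
  have hqρ : |q| ≤ Q * ρ ^ 2 := by
    rw [hq, abs_div, abs_two]
    have : |∑ i, κ i * inner ℝ (b i.castSucc) h ^ 2| ≤ Q * ρ ^ 2 := by
      rw [hQ, Finset.sum_mul]
      refine (Finset.abs_sum_le_sum_abs _ _).trans (Finset.sum_le_sum fun i _ => ?_)
      rw [abs_mul, abs_pow]
      refine mul_le_mul_of_nonneg_left (pow_le_pow_left₀ (abs_nonneg _) ?_ 2) (abs_nonneg _)
      simpa [b.orthonormal.1 i.castSucc] using abs_real_inner_le_norm (b i.castSucc) h
    have h4 : 0 ≤ Q * ρ ^ 2 := by positivity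
    linarith
  have hΛρ : Λ * ρ ≤ 1 / 2 := by linarith
  have hl1 : 1 / 2 ≤ 1 + l := by linarith [(abs_le.1 hlρ).1]
  have hql : |q * l| ≤ Q * Λ * ρ ^ 3 := by
    rw [abs_mul]
    refine (mul_le_mul hqρ hlρ (abs_nonneg _) (by positivity)).trans (le_of_eq (by ring))
  have hKc : c * (K / c * ρ ^ 3) = K * ρ ^ 3 := by field_simp
  have hw : (Q * Λ + K / c) * ρ ^ 3 ≤ 2 * (Q * Λ + K / c) * ρ ^ 3 * (1 + l) := by
    have : 0 ≤ (Q * Λ + K / c) * ρ ^ 3 := by positivity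
    nlinarith
  constructor
  · intro hlt
    have s1 := mul_lt_mul_of_pos_right hlt (by linarith : 0 < 1 + l)
    have s2 : K / c * ρ ^ 3 < z * (1 + l) - q := by
      have := (abs_le.1 hql).1
      linarith
    have s3 := mul_lt_mul_of_pos_left s2 hc
    rw [hKc] at s3
    linarith [(abs_le.1 hT).1]
  · intro hlt
    have s1 := mul_lt_mul_of_pos_right hlt (by linarith : 0 < 1 + l)
    have s2 : z * (1 + l) - q < -(K / c * ρ ^ 3) := by
      have := (abs_le.1 hql).2
      linarith
    have s3 := mul_lt_mul_of_pos_left s2 hc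
    rw [mul_neg, hKc] at s3
    linarith [(abs_le.1 hT).2]

end Region

section AdaptedFrame

variable {n : ℕ} {S : Set (EuclideanSpace ℝ (Fin (n + 1)))}
  {N : EuclideanSpace ℝ (Fin (n + 1)) → EuclideanSpace ℝ (Fin (n + 1))}
  {p : EuclideanSpace ℝ (Fin (n + 1))} {κ : Fin n → ℝ}
  {e : Fin n → EuclideanSpace ℝ (Fin (n + 1))}

lemma exists_adapted_orthonormalBasis (hp : p ∈ S) (hN : IsUnitNormalFieldAround S N p)
    (he : IsPrincipalBasis S N p κ e) :
    ∃ b : OrthonormalBasis (Fin (n + 1)) ℝ (EuclideanSpace ℝ (Fin (n + 1))),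
      (∀ μ : Fin n, b μ.castSucc = e μ) ∧ b (Fin.last n) = N p := by
  obtain ⟨V, -, hpV, -, hNS⟩ := hN
  obtain ⟨hN1, hNt⟩ := hNS p ⟨hp, hpV⟩
  have hon : Orthonormal ℝ (Fin.snoc e (N p) : Fin (n + 1) → EuclideanSpace ℝ (Fin (n + 1))) := by
    have h0 := orthonormal_iff_ite.1 he.orthonormal
    rw [orthonormal_iff_ite]
    intro i j
    refine Fin.lastCases ?_ (fun i => ?_) i <;> refine Fin.lastCases ?_ (fun j => ?_) j
    · simp [hN1]
    · simp [real_inner_comm (e j) (N p), hNt _ (he.tangent j), (Fin.castSucc_lt_last j).ne']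
    · simp [hNt _ (he.tangent i), (Fin.castSucc_lt_last i).ne]
    · simp [h0]
  obtain ⟨b, hb⟩ := Orthonormal.exists_orthonormalBasis_extension_of_card_eq (𝕜 := ℝ)
    (ι := Fin (n + 1)) (by simp) (s := Set.univ) (hon.comp _ Subtype.val_injective)
  exact ⟨b, fun μ => by rw [hb _ (Set.mem_univ _)]; simp, by rw [hb _ (Set.mem_univ _)]; simp⟩

/-- Near `p`, the spherical component is cut out of the ball by a continuous function whose sign is
decided by the osculating quadric of the hypersurface, up to an error of third order. -/
lemma exists_sphericalComponent_description (hS : IsSmoothHypersurface S) (hp : p ∈ S)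
    (hN : IsUnitNormalFieldAround S N p) (he : IsPrincipalBasis S N p κ e)
    (b : OrthonormalBasis (Fin (n + 1)) ℝ (EuclideanSpace ℝ (Fin (n + 1))))
    (hbe : ∀ μ : Fin n, b μ.castSucc = e μ) (hbN : b (Fin.last n) = N p) :
    ∃ r > 0, ∃ K : ℝ, 0 ≤ K ∧ ∀ ε, 0 < ε → ε < r →
      MeasurableSet (sphericalComponent S N p ε) ∧
      sphericalComponent S N p ε ⊆ Metric.closedBall p ε ∧
      ∀ x ∈ Metric.closedBall p ε,
        ((∑ i, κ i * inner ℝ (b i.castSucc) (x - p) ^ 2) / 2 + K * ‖x - p‖ ^ 3 <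
          inner ℝ (b (Fin.last n)) (x - p) → x ∈ sphericalComponent S N p ε) ∧
        (inner ℝ (b (Fin.last n)) (x - p) <
          (∑ i, κ i * inner ℝ (b i.castSucc) (x - p) ^ 2) / 2 - K * ‖x - p‖ ^ 3 →
            x ∉ sphericalComponent S N p ε) := by
  have hN1 : ‖N p‖ = 1 := hbN ▸ b.orthonormal.1 _
  have hNt : ∀ v ∈ tangentVectorsAt S p, inner ℝ v (N p) = 0 := by
    obtain ⟨V, -, hpV, -, hNS⟩ := hN
    exact (hNS p ⟨hp, hpV⟩).2
  -- a defining function that increases in the direction of the normal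
  obtain ⟨U, f, hU, hpU, hfU, hf', hSU, hpos⟩ : ∃ (U : Set (EuclideanSpace ℝ (Fin (n + 1))))
      (f : EuclideanSpace ℝ (Fin (n + 1)) → ℝ), IsOpen U ∧ p ∈ U ∧ ContDiffOn ℝ ∞ f U ∧
      (∀ x ∈ U, fderiv ℝ f x ≠ 0) ∧ S ∩ U = {x ∈ U | f x = 0} ∧ 0 < fderiv ℝ f p (N p) := by
    obtain ⟨U, f, hU, hpU, hfU, hf', hSU⟩ := hS p hp
    have hne : fderiv ℝ f p (N p) ≠ 0 := fun h0 => hf' p hpU <| by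
      ext w
      rw [fderiv_normal_mul_inner hU hfU hf' hSU ⟨hp, hpU⟩ hN1 hNt w, h0]
      simp
    rcases lt_or_gt_of_ne hne with h | h
    · have hneg : ∀ x, fderiv ℝ (fun x => -f x) x = -fderiv ℝ f x := fun x => fderiv_fun_neg
      refine ⟨U, fun x => -f x, hU, hpU, hfU.neg, fun x hx => ?_, ?_, ?_⟩
      · rw [hneg]; exact neg_ne_zero.2 (hf' x hx)
      · simpa using hSU
      · rw [hneg]; simpa using h
    · exact ⟨U, f, hU, hpU, hfU, hf', hSU, h⟩
  have hfp' : ContDiffAt ℝ ∞ f p := hfU.contDiffAt (hU.mem_nhds hpU)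
  have hfp : f p = 0 := by
    have : p ∈ S ∩ U := ⟨hp, hpU⟩
    rw [hSU] at this; exact this.2
  obtain ⟨r₁, hr₁, h₁⟩ := sphericalComponent_eq_pos hU hpU hfU.continuousOn
    (hfp'.of_le (by norm_cast)) hSU hp hN1 hpos
  obtain ⟨r₂, hr₂, K, hK0, hK⟩ := exists_sign_of_second_order b (κ := κ) hpos
    (hfp'.of_le (by norm_cast)) hfp
    (fun w => by
      rw [hbN, real_inner_comm]
      exact fderiv_normal_mul_inner hU hfU hf' hSU ⟨hp, hpU⟩ hN1 hNt w)
    (fun i j => by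
      rw [hbe, hbe, fderiv_fderiv_tangent hU hfU hf' hSU ⟨hp, hpU⟩ hN (he.tangent i) (he.tangent j),
        he.eigen, inner_smul_right, orthonormal_iff_ite.1 he.orthonormal]
      by_cases h : i = j
      · simp [h]
      · simp [h, Ne.symm h])
  obtain ⟨r₃, hr₃, hr₃U⟩ := Metric.isOpen_iff.1 hU p hpU
  refine ⟨min r₁ (min r₂ r₃), by positivity, K, hK0, fun ε hε hεr => ?_⟩
  have hε1 : ε < r₁ := hεr.trans_le (min_le_left _ _)
  have hε2 : ε < r₂ := hεr.trans_le ((min_le_right _ _).trans (min_le_left _ _))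
  have hε3 : ε < r₃ := hεr.trans_le ((min_le_right _ _).trans (min_le_right _ _))
  rw [h₁ ε hε hε1]
  refine ⟨?_, fun x hx => hx.1, fun x hx => ?_⟩
  · have hopen := hfU.continuousOn.isOpen_inter_preimage hU (isOpen_Ioi (a := (0 : ℝ)))
    have : {x ∈ Metric.closedBall p ε | 0 < f x} =
        Metric.closedBall p ε ∩ (U ∩ f ⁻¹' Set.Ioi 0) := by
      ext x
      constructor
      · intro hx
        exact ⟨hx.1, hr₃U (Metric.closedBall_subset_ball hε3 hx.1), hx.2⟩
      · intro hx
        exact ⟨hx.1, hx.2.2⟩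
    rw [this]
    exact measurableSet_closedBall.inter hopen.measurableSet
  · obtain ⟨k1, k2⟩ := hK x (Metric.closedBall_subset_ball hε2 hx)
    exact ⟨fun h => ⟨hx, k1 h⟩, fun h hmem => (k2 h).not_gt hmem.2⟩

end AdaptedFrame

/-! ### The covariance matrix as a bilinear form -/

lemma covarianceMatrix_isHermitian {m : ℕ} (D : Set (EuclideanSpace ℝ (Fin m))) :
    (covarianceMatrix D).IsHermitian := by
  ext i j
  simp [covarianceMatrix, mul_comm]

lemma inner_covarianceMatrix {m : ℕ} {D : Set (EuclideanSpace ℝ (Fin m))}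
    {p : EuclideanSpace ℝ (Fin m)} {R : ℝ} (hD : D ⊆ Metric.closedBall p R)
    (hvol : volume.real D ≠ 0) (u v : EuclideanSpace ℝ (Fin m)) :
    inner ℝ u (Matrix.toEuclideanLin (covarianceMatrix D) v) =
      (∫ x in D, inner ℝ u (x - p) * inner ℝ v (x - p)) -
        (∫ x in D, inner ℝ u (x - p)) * (∫ x in D, inner ℝ v (x - p)) / volume.real D := by
  have hint : ∀ {F : Type} [NormedAddCommGroup F] (g : EuclideanSpace ℝ (Fin m) → F),
      Continuous g → IntegrableOn g D := fun g hg =>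
    (hg.continuousOn.integrableOn_compact (isCompact_closedBall p R)).mono_set hD
  set s := barycenterOf D with hs
  have h1 : inner ℝ u (Matrix.toEuclideanLin (covarianceMatrix D) v) =
      ∫ x in D, inner ℝ u (x - s) * inner ℝ v (x - s) := by
    have e1 : ∀ x, inner ℝ u (x - s) * inner ℝ v (x - s) =
        ∑ i, ∑ j, u i * v j * ((x i - s i) * (x j - s j)) := fun x => by
      simp only [PiLp.inner_apply, RCLike.inner_apply, RCLike.conj_to_real, Finset.sum_mul_sum,
        PiLp.sub_apply]
      exact Finset.sum_congr rfl fun i _ => Finset.sum_congr rfl fun j _ => by ring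
    simp only [e1]
    rw [integral_finsetSum _ fun i _ => hint _ (by fun_prop)]
    rw [PiLp.inner_apply]
    refine Finset.sum_congr rfl fun i _ => ?_
    rw [integral_finsetSum _ fun j _ => hint _ (by fun_prop)]
    simp only [Matrix.toLpLin_apply, RCLike.inner_apply, RCLike.conj_to_real, Matrix.mulVec,
      dotProduct, covarianceMatrix, Matrix.of_apply, Finset.sum_mul, integral_const_mul]
    exact Finset.sum_congr rfl fun j _ => by ring
  have hbar : ∀ w, inner ℝ w (s - p) = (volume.real D)⁻¹ * ∫ x in D, inner ℝ w (x - p) := by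
    intro w
    have e2 : ∫ x in D, inner ℝ w (x - p) = inner ℝ w (∫ x in D, x) - volume.real D * inner ℝ w p := by
      simp only [inner_sub_right]
      rw [integral_sub (hint _ (by fun_prop)) (hint _ continuous_const), setIntegral_const,
        integral_inner (hint (fun x => x) continuous_id), smul_eq_mul]
    rw [e2, hs, barycenterOf, inner_sub_right, inner_smul_right, mul_sub, inv_mul_cancel_left₀ hvol]
  rw [h1]
  have e3 : ∀ x, inner ℝ u (x - s) * inner ℝ v (x - s) =
      inner ℝ u (x - p) * inner ℝ v (x - p) - inner ℝ v (s - p) * inner ℝ u (x - p) -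
        inner ℝ u (s - p) * inner ℝ v (x - p) + inner ℝ u (s - p) * inner ℝ v (s - p) := fun x => by
    rw [show x - s = (x - p) - (s - p) by abel, inner_sub_right u (x - p), inner_sub_right v (x - p)]
    ring
  simp only [e3]
  rw [integral_add (hint _ (by fun_prop)) (hint _ continuous_const),
    integral_sub (hint _ (by fun_prop)) (hint _ (by fun_prop)),
    integral_sub (hint _ (by fun_prop)) (hint _ (by fun_prop)), integral_const_mul,
    integral_const_mul, setIntegral_const, hbar, hbar, smul_eq_mul]
  field_simp
  ring

/-! ### Rescaling to the unit ball -/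

/-- A region near `p`, magnified by the factor `1 / ε` and expressed in the coordinates
`ℝⁿ × ℝ` given by an orthonormal basis. -/
def rescaledRegion {n : ℕ}
    (b : OrthonormalBasis (Fin (n + 1)) ℝ (EuclideanSpace ℝ (Fin (n + 1))))
    (p : EuclideanSpace ℝ (Fin (n + 1))) (ε : ℝ) (D : Set (EuclideanSpace ℝ (Fin (n + 1)))) :
    Set (EuclideanSpace ℝ (Fin n) × ℝ) :=
  {w | p + ε • (splitEquiv b).symm w ∈ D}

section Rescale

variable {n : ℕ} (b : OrthonormalBasis (Fin (n + 1)) ℝ (EuclideanSpace ℝ (Fin (n + 1))))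
  (p : EuclideanSpace ℝ (Fin (n + 1)))

lemma measurableSet_rescaledRegion (ε : ℝ) {D : Set (EuclideanSpace ℝ (Fin (n + 1)))}
    (hD : MeasurableSet D) : MeasurableSet (rescaledRegion b p ε D) :=
  (((splitEquiv b).symm.measurable.const_smul ε).const_add p) hD

lemma setIntegral_eq_rescaledRegion {ε : ℝ} (hε : 0 < ε)
    {D : Set (EuclideanSpace ℝ (Fin (n + 1)))} (hD : MeasurableSet D)
    (g : EuclideanSpace ℝ (Fin n) × ℝ → ℝ) :
    ∫ x in D, g (splitEquiv b (x - p)) =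
      ε ^ (n + 1) * ∫ w in rescaledRegion b p ε D, g (ε • w) := by
  set G := D.indicator fun x => g (splitEquiv b (x - p)) with hG
  have h1 : ∫ w in rescaledRegion b p ε D, g (ε • w) =
      ∫ w, G (p + ε • (splitEquiv b).symm w) := by
    rw [← integral_indicator (measurableSet_rescaledRegion b p ε hD)]
    congr 1
    ext w
    classical
    simp only [Set.indicator_apply, hG, rescaledRegion, Set.mem_ofPred_eq, add_sub_cancel_left,
      splitEquiv_smul, MeasurableEquiv.apply_symm_apply]
  have h2 : ∫ w, G (p + ε • (splitEquiv b).symm w) = ∫ x, G (p + ε • x) :=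
    ((measurePreserving_splitEquiv b).symm.integral_comp
      (splitEquiv b).symm.measurableEmbedding fun x => G (p + ε • x))
  have h3 := Measure.integral_comp_smul (volume : Measure (EuclideanSpace ℝ (Fin (n + 1))))
    (fun x => G (p + x)) ε
  rw [h1, h2, h3, integral_add_left_eq_self, finrank_euclideanSpace_fin, abs_of_pos (by positivity),
    smul_eq_mul, mul_inv_cancel_left₀ (by positivity), hG, integral_indicator hD]

end Rescale

/-! ### Asymptotics of the moments of the rescaled spherical component -/

/-- A family of subregions of the unit ball of `ℝⁿ × ℝ` that agrees with the part above the graph of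
`ε q` outside a layer of thickness `O(ε²)`, as `ε → 0⁺`. -/
def IsNearlyAboveGraph {n : ℕ} (q : EuclideanSpace ℝ (Fin n) → ℝ)
    (R : ℝ → Set (EuclideanSpace ℝ (Fin n) × ℝ)) : Prop :=
  ∃ r > 0, ∃ K : ℝ, 0 ≤ K ∧ ∀ ε, 0 < ε → ε < r → MeasurableSet (R ε) ∧ R ε ⊆ splitBall n ∧
    (∀ w ∈ splitBall n, ε * q w.1 + K * ε ^ 2 < w.2 → w ∈ R ε) ∧
    (∀ w ∈ splitBall n, w.2 < ε * q w.1 - K * ε ^ 2 → w ∉ R ε)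

/-- The quadratic form `½ ∑ κᵢ yᵢ²`, whose graph is the osculating quadric of a hypersurface with
principal curvatures `κ`. -/
noncomputable def osculatingQuadric {n : ℕ} (κ : Fin n → ℝ) (y : EuclideanSpace ℝ (Fin n)) : ℝ :=
  (∑ i, κ i * y i ^ 2) / 2

lemma continuous_osculatingQuadric {n : ℕ} (κ : Fin n → ℝ) : Continuous (osculatingQuadric κ) := by
  unfold osculatingQuadric
  fun_prop

lemma IsNearlyAboveGraph.isBigO_setIntegral {n : ℕ} {q : EuclideanSpace ℝ (Fin n) → ℝ}
    {R : ℝ → Set (EuclideanSpace ℝ (Fin n) × ℝ)} (hR : IsNearlyAboveGraph q R)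
    (hq : Continuous q) {g : EuclideanSpace ℝ (Fin n) × ℝ → ℝ} (hg : Continuous g)
    (hL : ∀ y ∈ unitBall n, ∀ z : ℝ, |z| ≤ 1 → |g (y, z) - g (y, 0)| ≤ |z|)
    {I₀ I₁ : ℝ} (h₀ : ∫ w in upperHalfBall n, g w = I₀)
    (h₁ : ∫ y in unitBall n, g (y, 0) * q y = I₁) :
    (fun ε => (∫ w in R ε, g w) - (I₀ - ε * I₁)) =O[𝓝[>] 0] fun ε => ε ^ 2 := by
  obtain ⟨r, hr, K, hK, h⟩ := hR
  obtain ⟨C, ε₀, hε₀, hC⟩ := exists_bound_setIntegral_near_upperHalfBall hq hg (L := 1)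
    (by simpa using hL) hK
  refine IsBigO.of_bound C ?_
  filter_upwards [Ioo_mem_nhdsGT (lt_min hr hε₀)] with ε hε
  obtain ⟨m1, m2, m3, m4⟩ := h ε hε.1 (hε.2.trans_le (min_le_left _ _))
  have := hC ε hε.1 (hε.2.trans_le (min_le_right _ _)) (R ε) m1 m2 m3 m4
  rw [h₀, h₁] at this
  rw [Real.norm_eq_abs, Real.norm_of_nonneg (sq_nonneg ε)]
  convert this using 2
  ring

lemma setIntegral_osculatingQuadric {n : ℕ} (κ : Fin n → ℝ) :
    ∫ y in unitBall n, osculatingQuadric κ y = (∑ i, κ i) * (ballVolume n 1 / (2 * (n + 2))) := by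
  unfold osculatingQuadric
  rw [integral_div, integral_finsetSum _ fun i _ => integrableOn_unitBall (by fun_prop)]
  simp only [integral_const_mul, setIntegral_unitBall_sq, ← Finset.sum_mul]
  field_simp

lemma setIntegral_mul_osculatingQuadric {n : ℕ} (κ : Fin n → ℝ) (i : Fin n) :
    ∫ y in unitBall n, y i * osculatingQuadric κ y = 0 := by
  have h := setIntegral_unitBall_comp (LinearIsometryEquiv.neg ℝ)
    fun y : EuclideanSpace ℝ (Fin n) => y i * osculatingQuadric κ y
  simp only [LinearIsometryEquiv.coe_neg, osculatingQuadric, PiLp.neg_apply, neg_sq, neg_mul,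
    integral_neg] at h
  simp only [osculatingQuadric]
  linarith

lemma setIntegral_mul_mul_osculatingQuadric {n : ℕ} (κ : Fin n → ℝ) (i j : Fin n) :
    ∫ y in unitBall n, y i * y j * osculatingQuadric κ y =
      if i = j then (2 * κ i + ∑ k, κ k) * (ballVolume n 1 / (2 * (n + 2) * (n + 4))) else 0 := by
  have h1 : ∀ y : EuclideanSpace ℝ (Fin n), y i * y j * osculatingQuadric κ y =
      ∑ k, κ k / 2 * (y i * y j * y k ^ 2) := fun y => by
    rw [osculatingQuadric, mul_div_assoc', Finset.mul_sum, Finset.sum_div]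
    exact Finset.sum_congr rfl fun k _ => by ring
  simp only [h1]
  rw [integral_finsetSum _ fun k _ => integrableOn_unitBall (by fun_prop)]
  simp only [integral_const_mul, setIntegral_unitBall_mul_mul_sq]
  split_ifs with h
  · have h2 : ∀ k, κ k / 2 * ((if i = k then 3 else 1) * (ballVolume n 1 / ((n + 2) * (n + 4)))) =
        (κ k + if i = k then 2 * κ k else 0) * (ballVolume n 1 / (2 * (n + 2) * (n + 4))) := by
      intro k
      split_ifs <;> field_simp <;> ring
    simp only [h2, ← Finset.sum_mul, Finset.sum_add_distrib, Finset.sum_ite_eq, Finset.mem_univ,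
      if_true]
    ring
  · simp

section Moments

variable {n : ℕ} {κ : Fin n → ℝ} {R : ℝ → Set (EuclideanSpace ℝ (Fin n) × ℝ)}

lemma IsNearlyAboveGraph.volume_isBigO (hR : IsNearlyAboveGraph (osculatingQuadric κ) R) :
    (fun ε => (∫ _ in R ε, (1 : ℝ)) - (ballVolume (n + 1) 1 / 2 -
      ε * ((∑ i, κ i) * (ballVolume n 1 / (2 * (n + 2)))))) =O[𝓝[>] 0] fun ε => ε ^ 2 :=
  hR.isBigO_setIntegral (continuous_osculatingQuadric κ) continuous_const (fun _ _ _ _ => by simp)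
    (setIntegral_upperHalfBall_one n) (by simpa using setIntegral_osculatingQuadric κ)

lemma IsNearlyAboveGraph.fst_isBigO (hR : IsNearlyAboveGraph (osculatingQuadric κ) R) (i : Fin n) :
    (fun ε => ∫ w in R ε, w.1 i) =O[𝓝[>] 0] fun ε => ε ^ 2 := by
  simpa using hR.isBigO_setIntegral (continuous_osculatingQuadric κ) (g := fun w => w.1 i)
    (by fun_prop) (fun _ _ _ _ => by simp) (setIntegral_upperHalfBall_fst n i)
    (setIntegral_mul_osculatingQuadric κ i)

lemma IsNearlyAboveGraph.snd_isBigO (hR : IsNearlyAboveGraph (osculatingQuadric κ) R) :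
    (fun ε => (∫ w in R ε, w.2) - ballVolume n 1 / (n + 2)) =O[𝓝[>] 0] fun ε => ε ^ 2 := by
  simpa using hR.isBigO_setIntegral (continuous_osculatingQuadric κ) (g := fun w => w.2)
    (by fun_prop) (fun _ _ _ _ => by simp) (setIntegral_upperHalfBall_snd n) (I₁ := 0) (by simp)

lemma IsNearlyAboveGraph.fst_mul_fst_isBigO (hR : IsNearlyAboveGraph (osculatingQuadric κ) R)
    (i j : Fin n) :
    (fun ε => (∫ w in R ε, w.1 i * w.1 j) -
      ((if i = j then ballVolume (n + 1) 1 / (2 * (n + 3)) else 0) -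
        ε * if i = j then (2 * κ i + ∑ k, κ k) * (ballVolume n 1 / (2 * (n + 2) * (n + 4))) else 0))
      =O[𝓝[>] 0] fun ε => ε ^ 2 :=
  hR.isBigO_setIntegral (continuous_osculatingQuadric κ) (g := fun w => w.1 i * w.1 j)
    (by fun_prop) (fun _ _ _ _ => by simp) (setIntegral_upperHalfBall_fst_mul_fst n i j)
    (setIntegral_mul_mul_osculatingQuadric κ i j)

lemma IsNearlyAboveGraph.fst_mul_snd_isBigO (hR : IsNearlyAboveGraph (osculatingQuadric κ) R)
    (i : Fin n) :
    (fun ε => ∫ w in R ε, w.1 i * w.2) =O[𝓝[>] 0] fun ε => ε ^ 2 := by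
  simpa using hR.isBigO_setIntegral (continuous_osculatingQuadric κ) (g := fun w => w.1 i * w.2)
    (by fun_prop) (fun y hy z _ => by
      have h1 : |y i| ≤ 1 := by
        have := PiLp.norm_apply_le y i
        rw [Real.norm_eq_abs] at this
        exact this.trans (mem_closedBall_zero_iff.1 hy)
      simpa [abs_mul] using mul_le_of_le_one_left (abs_nonneg z) h1)
    (setIntegral_upperHalfBall_fst_mul_snd n i) (I₁ := 0) (by simp)

lemma IsNearlyAboveGraph.snd_sq_isBigO (hR : IsNearlyAboveGraph (osculatingQuadric κ) R) :
    (fun ε => (∫ w in R ε, w.2 ^ 2) - ballVolume (n + 1) 1 / (2 * (n + 3)))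
      =O[𝓝[>] 0] fun ε => ε ^ 2 := by
  simpa using hR.isBigO_setIntegral (continuous_osculatingQuadric κ) (g := fun w => w.2 ^ 2)
    (by fun_prop) (fun y _ z hz => by
      simpa [sq, abs_mul] using mul_le_of_le_one_left (abs_nonneg z) hz)
    (setIntegral_upperHalfBall_snd_sq n) (I₁ := 0) (by simp)

end Moments

/-- First-order expansion of a quotient `m² / V`. -/
lemma isBigO_sq_div_sub {V m : ℝ → ℝ} {v₀ v₁ m₀ : ℝ} (hv : v₀ ≠ 0)
    (hV : (fun ε => V ε - (v₀ - ε * v₁)) =O[𝓝[>] 0] fun ε => ε ^ 2)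
    (hm : (fun ε => m ε - m₀) =O[𝓝[>] 0] fun ε => ε ^ 2) :
    Tendsto V (𝓝[>] 0) (𝓝 v₀) ∧ Tendsto m (𝓝[>] 0) (𝓝 m₀) ∧
    (fun ε => m ε * m ε / V ε - m₀ ^ 2 / v₀ * (1 + v₁ / v₀ * ε)) =O[𝓝[>] 0] fun ε => ε ^ 2 := by
  have hid : Tendsto (fun ε : ℝ => ε) (𝓝[>] 0) (𝓝 0) := tendsto_nhdsWithin_of_tendsto_nhds tendsto_id
  have hsq : Tendsto (fun ε : ℝ => ε ^ 2) (𝓝[>] 0) (𝓝 0) := by simpa using hid.pow 2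
  have hVt : Tendsto V (𝓝[>] 0) (𝓝 v₀) := by
    have h1 := hV.trans_tendsto hsq
    have h2 : Tendsto (fun ε => v₀ - ε * v₁) (𝓝[>] 0) (𝓝 v₀) := by
      simpa using (hid.mul_const v₁).const_sub v₀
    simpa using h1.add h2
  have hmt : Tendsto m (𝓝[>] 0) (𝓝 m₀) := by
    simpa using (hm.trans_tendsto hsq).add_const m₀
  refine ⟨hVt, hmt, ?_⟩
  have hinv : (fun ε => (V ε)⁻¹) =O[𝓝[>] 0] fun _ => (1 : ℝ) :=
    (hVt.inv₀ hv).isBigO_one ℝ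
  have h1 : (fun ε => (m ε - m₀) * (m ε + m₀)) =O[𝓝[>] 0] fun ε => ε ^ 2 := by
    simpa using hm.mul ((hmt.add_const m₀).isBigO_one ℝ)
  have h2 : (fun ε => (V ε - (v₀ - ε * v₁)) * (1 + v₁ / v₀ * ε)) =O[𝓝[>] 0] fun ε => ε ^ 2 := by
    have : Tendsto (fun ε : ℝ => 1 + v₁ / v₀ * ε) (𝓝[>] 0) (𝓝 (1 + v₁ / v₀ * 0)) :=
      (hid.const_mul _).const_add 1
    simpa using hV.mul (this.isBigO_one ℝ)
  have h3 : (fun ε => ((m ε - m₀) * (m ε + m₀) + m₀ ^ 2 / v₀ * (v₁ ^ 2 / v₀ * ε ^ 2) -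
      m₀ ^ 2 / v₀ * ((V ε - (v₀ - ε * v₁)) * (1 + v₁ / v₀ * ε))) * (V ε)⁻¹)
        =O[𝓝[>] 0] fun ε => ε ^ 2 := by
    simpa using ((h1.add (((isBigO_refl _ _).const_mul_left _).const_mul_left _)).sub
      (h2.const_mul_left _)).mul hinv
  refine h3.congr' ?_ EventuallyEq.rfl
  filter_upwards [hVt.eventually_ne hv] with ε hε
  field_simp
  ring

/-! ### The covariance matrix in the adapted frame -/

/-- The coordinates of `ℝⁿ × ℝ ≃ ℝⁿ⁺¹`. -/
def splitCoord {n : ℕ} (i : Fin (n + 1)) (w : EuclideanSpace ℝ (Fin n) × ℝ) : ℝ :=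
  Fin.lastCases (motive := fun _ => ℝ) w.2 (fun μ => w.1 μ) i

section SplitCoord

variable {n : ℕ}

@[simp]
lemma splitCoord_last (w : EuclideanSpace ℝ (Fin n) × ℝ) : splitCoord (Fin.last n) w = w.2 := by
  simp [splitCoord]

@[simp]
lemma splitCoord_castSucc (μ : Fin n) (w : EuclideanSpace ℝ (Fin n) × ℝ) :
    splitCoord μ.castSucc w = w.1 μ := by
  simp [splitCoord]

lemma splitCoord_splitEquiv
    (b : OrthonormalBasis (Fin (n + 1)) ℝ (EuclideanSpace ℝ (Fin (n + 1)))) (i : Fin (n + 1))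
    (x : EuclideanSpace ℝ (Fin (n + 1))) : splitCoord i (splitEquiv b x) = inner ℝ (b i) x := by
  refine Fin.lastCases ?_ (fun μ => ?_) i
  · rw [splitCoord_last, splitEquiv_snd]
  · rw [splitCoord_castSucc, splitEquiv_fst]

lemma splitCoord_smul (i : Fin (n + 1)) (c : ℝ) (w : EuclideanSpace ℝ (Fin n) × ℝ) :
    splitCoord i (c • w) = c * splitCoord i w := by
  refine Fin.lastCases ?_ (fun μ => ?_) i <;> simp

end SplitCoord

lemma inner_covarianceMatrix_eq_rescaled {n : ℕ}
    (b : OrthonormalBasis (Fin (n + 1)) ℝ (EuclideanSpace ℝ (Fin (n + 1))))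
    (p : EuclideanSpace ℝ (Fin (n + 1))) {ε : ℝ} (hε : 0 < ε)
    {D : Set (EuclideanSpace ℝ (Fin (n + 1)))} (hD : MeasurableSet D)
    (hDε : D ⊆ Metric.closedBall p ε)
    (hvol : ∫ _ in rescaledRegion b p ε D, (1 : ℝ) ≠ 0) (i j : Fin (n + 1)) :
    inner ℝ (b i) (Matrix.toEuclideanLin (covarianceMatrix D) (b j)) =
      ε ^ (n + 3) * ((∫ w in rescaledRegion b p ε D, splitCoord i w * splitCoord j w) -
        (∫ w in rescaledRegion b p ε D, splitCoord i w) *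
          (∫ w in rescaledRegion b p ε D, splitCoord j w) /
            ∫ _ in rescaledRegion b p ε D, (1 : ℝ)) := by
  have h0 := setIntegral_eq_rescaledRegion b p hε hD fun _ => 1
  have h1 : ∀ i, ∫ x in D, inner ℝ (b i) (x - p) =
      ε ^ (n + 1) * (ε * ∫ w in rescaledRegion b p ε D, splitCoord i w) := fun i => by
    have := setIntegral_eq_rescaledRegion b p hε hD (splitCoord i)
    simpa only [splitCoord_splitEquiv, splitCoord_smul, integral_const_mul] using this
  have h2 : ∫ x in D, inner ℝ (b i) (x - p) * inner ℝ (b j) (x - p) =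
      ε ^ (n + 1) * (ε ^ 2 * ∫ w in rescaledRegion b p ε D, splitCoord i w * splitCoord j w) := by
    have := setIntegral_eq_rescaledRegion b p hε hD fun w => splitCoord i w * splitCoord j w
    simp only [splitCoord_splitEquiv, splitCoord_smul] at this
    rw [this]
    congr 1
    rw [← integral_const_mul]
    congr 1
    funext w
    ring
  set V := ∫ _ in rescaledRegion b p ε D, (1 : ℝ) with hV
  have hvD : volume.real D = ε ^ (n + 1) * V := by
    rw [← h0]; simp
  rw [inner_covarianceMatrix hDε (by rw [hvD]; positivity), h1, h1, h2, hvD]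
  have : ε ≠ 0 := hε.ne'
  field_simp
  ring

/-- The leading terms of the eigenvalues of the covariance matrix of the spherical component: the
last one belongs to the normal, the others to the principal directions. -/
noncomputable def approxEigenvalue {n : ℕ} (κ : Fin n → ℝ) (ε : ℝ) (i : Fin (n + 1)) : ℝ :=
  Fin.lastCases (motive := fun _ => ℝ)
    (ballVolume (n + 1) ε * (ε ^ 2 / (2 * ((n : ℝ) + 3))) -
      2 * (ballVolume n ε ^ 2 / ballVolume (n + 1) ε) * (ε ^ 4 / ((n : ℝ) + 2) ^ 2) *
        (1 + ballVolume n ε / ballVolume (n + 1) ε * (ε ^ 2 / ((n : ℝ) + 2)) * ∑ μ, κ μ))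
    (fun μ => ballVolume (n + 1) ε * (ε ^ 2 / (2 * ((n : ℝ) + 3))) -
      ballVolume n ε * (ε ^ 4 / (2 * ((n : ℝ) + 2) * ((n : ℝ) + 4))) * (2 * κ μ + ∑ μ, κ μ)) i

section ApproxEigenvalue

variable {n : ℕ} (κ : Fin n → ℝ)

lemma approxEigenvalue_castSucc {ε : ℝ} (hε : 0 < ε) (μ : Fin n) :
    approxEigenvalue κ ε μ.castSucc = ε ^ (n + 3) * (ballVolume (n + 1) 1 / (2 * (n + 3)) -
      ε * ((2 * κ μ + ∑ k, κ k) * (ballVolume n 1 / (2 * (n + 2) * (n + 4))))) := by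
  simp only [approxEigenvalue, Fin.lastCases_castSucc]
  rw [ballVolume_eq n hε.le, ballVolume_eq (n + 1) hε.le]
  ring

lemma approxEigenvalue_last {ε : ℝ} (hε : 0 < ε) :
    approxEigenvalue κ ε (Fin.last n) = ε ^ (n + 3) * (ballVolume (n + 1) 1 / (2 * (n + 3)) -
      (ballVolume n 1 / (n + 2)) ^ 2 / (ballVolume (n + 1) 1 / 2) *
        (1 + (∑ i, κ i) * (ballVolume n 1 / (2 * (n + 2))) / (ballVolume (n + 1) 1 / 2) * ε)) := by
  have h1 := (ballVolume_one_pos (n + 1)).ne'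
  simp only [approxEigenvalue, Fin.lastCases_last]
  rw [ballVolume_eq n hε.le, ballVolume_eq (n + 1) hε.le]
  have : ε ≠ 0 := hε.ne'
  field_simp
  ring

/-- The gap between two tangential eigenvalues is of order `ε ^ (n + 4)`. -/
lemma exists_tangential_gap {μ ν : Fin n} (h : κ ν ≠ κ μ) :
    ∃ g > 0, ∀ᶠ ε in 𝓝[>] (0 : ℝ), g * ε ^ (n + 4) ≤
      |approxEigenvalue κ ε μ.castSucc - approxEigenvalue κ ε ν.castSucc| := by
  have hω := ballVolume_one_pos n
  refine ⟨|κ ν - κ μ| * (ballVolume n 1 / ((n + 2) * (n + 4))),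
    mul_pos (abs_pos.2 (sub_ne_zero.2 h)) (by positivity), ?_⟩
  filter_upwards [self_mem_nhdsWithin] with ε hε
  have hε : 0 < ε := hε
  rw [approxEigenvalue_castSucc κ hε, approxEigenvalue_castSucc κ hε]
  have : ∀ A B : ℝ, ε ^ (n + 3) * (A - ε * ((2 * κ μ + B) * (ballVolume n 1 / (2 * (n + 2) * (n + 4)))))
      - ε ^ (n + 3) * (A - ε * ((2 * κ ν + B) * (ballVolume n 1 / (2 * (n + 2) * (n + 4))))) =
      (κ ν - κ μ) * ((ballVolume n 1 / ((n + 2) * (n + 4))) * ε ^ (n + 4)) := fun A B => by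
    field_simp
    ring
  rw [this, abs_mul, abs_of_pos (a := _ * ε ^ (n + 4)) (by positivity), mul_assoc]

/-- The gap between the normal eigenvalue and a tangential one is of order `ε ^ (n + 3)`. -/
lemma exists_normal_gap (μ : Fin n) :
    ∃ g > 0, ∀ᶠ ε in 𝓝[>] (0 : ℝ), g * ε ^ (n + 3) ≤
      approxEigenvalue κ ε μ.castSucc - approxEigenvalue κ ε (Fin.last n) := by
  have hω := ballVolume_one_pos n
  have hω' := ballVolume_one_pos (n + 1)
  set c := (ballVolume n 1 / (n + 2)) ^ 2 / (ballVolume (n + 1) 1 / 2) with hc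
  have hc0 : 0 < c := by positivity
  refine ⟨c / 2, by positivity, ?_⟩
  have ht : Tendsto (fun ε : ℝ =>
      c * (1 + (∑ i, κ i) * (ballVolume n 1 / (2 * (n + 2))) / (ballVolume (n + 1) 1 / 2) * ε) -
        ε * ((2 * κ μ + ∑ k, κ k) * (ballVolume n 1 / (2 * (n + 2) * (n + 4)))))
      (𝓝[>] 0) (𝓝 c) := by
    apply tendsto_nhdsWithin_of_tendsto_nhds
    apply Continuous.tendsto' (by fun_prop)
    simp
  filter_upwards [self_mem_nhdsWithin, ht.eventually_const_le (by linarith : c / 2 < c)] with ε hε h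
  have hε : 0 < ε := hε
  rw [approxEigenvalue_castSucc κ hε, approxEigenvalue_last κ hε, ← hc]
  have := mul_le_mul_of_nonneg_left h (pow_pos hε (n + 3)).le
  linarith

end ApproxEigenvalue

section Main

variable {n : ℕ} {S : Set (EuclideanSpace ℝ (Fin (n + 1)))}
  {N : EuclideanSpace ℝ (Fin (n + 1)) → EuclideanSpace ℝ (Fin (n + 1))}
  {p : EuclideanSpace ℝ (Fin (n + 1))} {κ : Fin n → ℝ}
  {e : Fin n → EuclideanSpace ℝ (Fin (n + 1))}

lemma isNearlyAboveGraph_rescaledRegion (hS : IsSmoothHypersurface S) (hp : p ∈ S)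
    (hN : IsUnitNormalFieldAround S N p) (he : IsPrincipalBasis S N p κ e)
    (b : OrthonormalBasis (Fin (n + 1)) ℝ (EuclideanSpace ℝ (Fin (n + 1))))
    (hbe : ∀ μ : Fin n, b μ.castSucc = e μ) (hbN : b (Fin.last n) = N p) :
    IsNearlyAboveGraph (osculatingQuadric κ)
      fun ε => rescaledRegion b p ε (sphericalComponent S N p ε) := by
  obtain ⟨r, hr, K, hK, h⟩ := exists_sphericalComponent_description hS hp hN he b hbe hbN
  refine ⟨r, hr, K, hK, fun ε hε hεr => ?_⟩
  obtain ⟨hm, hsub, hsign⟩ := h ε hε hεr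
  have hnorm : ∀ w, ‖p + ε • (splitEquiv b).symm w - p‖ = ε * ‖(splitEquiv b).symm w‖ := fun w => by
    rw [add_sub_cancel_left, norm_smul, Real.norm_of_nonneg hε.le]
  have hball : ∀ w, p + ε • (splitEquiv b).symm w ∈ Metric.closedBall p ε ↔ w ∈ splitBall n := by
    intro w
    rw [mem_closedBall_iff_norm, hnorm, mul_le_iff_le_one_right hε, ← mem_closedBall_zero_iff,
      show Metric.closedBall 0 1 = unitBall (n + 1) from rfl, ← splitEquiv_preimage_splitBall b,
      Set.mem_preimage, MeasurableEquiv.apply_symm_apply]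
  have hcoord : ∀ i w, inner ℝ (b i) (p + ε • (splitEquiv b).symm w - p) =
      ε * splitCoord i w := fun i w => by
    rw [add_sub_cancel_left, inner_smul_right, ← splitCoord_splitEquiv,
      MeasurableEquiv.apply_symm_apply]
  have hquad : ∀ w : EuclideanSpace ℝ (Fin n) × ℝ,
      (∑ i : Fin n, κ i * inner ℝ (b i.castSucc) (p + ε • (splitEquiv b).symm w - p) ^ 2) / 2 =
        ε * (ε * osculatingQuadric κ w.1) := fun w => by
    simp only [hcoord, splitCoord_castSucc, osculatingQuadric, mul_div_assoc', Finset.mul_sum]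
    congr 1
    exact Finset.sum_congr rfl fun i _ => by ring
  have hcube : ∀ w ∈ splitBall n,
      K * ‖p + ε • (splitEquiv b).symm w - p‖ ^ 3 ≤ ε * (K * ε ^ 2) := fun w hw => by
    have := pow_le_pow_left₀ (norm_nonneg _) (mem_closedBall_iff_norm.1 ((hball w).2 hw)) 3
    have := mul_le_mul_of_nonneg_left this hK
    linarith
  refine ⟨measurableSet_rescaledRegion b p ε hm, fun w hw => (hball w).1 (hsub hw), ?_, ?_⟩
  · intro w hw hlt
    refine (hsign _ ((hball w).2 hw)).1 ?_
    rw [hquad, hcoord, splitCoord_last]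
    have := mul_lt_mul_of_pos_left hlt hε
    have := hcube w hw
    linarith
  · intro w hw hlt
    refine (hsign _ ((hball w).2 hw)).2 ?_
    rw [hquad, hcoord, splitCoord_last]
    have := mul_lt_mul_of_pos_left hlt hε
    have := hcube w hw
    linarith

/-- In the frame of the principal directions and the normal, the covariance matrix of the spherical
component is diagonal up to `O(ε ^ (n + 5))`. -/
lemma diagonalDefect_isBigO (hS : IsSmoothHypersurface S) (hp : p ∈ S)
    (hN : IsUnitNormalFieldAround S N p) (he : IsPrincipalBasis S N p κ e)
    (b : OrthonormalBasis (Fin (n + 1)) ℝ (EuclideanSpace ℝ (Fin (n + 1))))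
    (hbe : ∀ μ : Fin n, b μ.castSucc = e μ) (hbN : b (Fin.last n) = N p) :
    (fun ε => diagonalDefect
      (Matrix.toEuclideanLin (covarianceMatrix (sphericalComponent S N p ε))) b
        (approxEigenvalue κ ε)) =O[𝓝[>] 0] fun ε => ε ^ (n + 5) := by
  have hR := isNearlyAboveGraph_rescaledRegion hS hp hN he b hbe hbN
  obtain ⟨r, hr, K, hK, hdesc⟩ := exists_sphericalComponent_description hS hp hN he b hbe hbN
  set R := fun ε => rescaledRegion b p ε (sphericalComponent S N p ε) with hRdef
  have hω' := ballVolume_one_pos (n + 1)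
  obtain ⟨hVt, hmt, hquot⟩ := isBigO_sq_div_sub (by positivity) hR.volume_isBigO hR.snd_isBigO
  have hinv : (fun ε => (∫ _ in R ε, (1 : ℝ))⁻¹) =O[𝓝[>] 0] fun _ => (1 : ℝ) :=
    (hVt.inv₀ (by positivity)).isBigO_one ℝ
  have hsq1 : (fun ε : ℝ => ε ^ 2) =O[𝓝[>] 0] fun _ => (1 : ℝ) := by
    have : Tendsto (fun ε : ℝ => ε ^ 2) (𝓝[>] 0) (𝓝 0) :=
      tendsto_nhdsWithin_of_tendsto_nhds (Continuous.tendsto' (by fun_prop) _ _ (by simp))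
    exact this.isBigO_one ℝ
  have hm1 : ∀ i, (fun ε => ∫ w in R ε, splitCoord i w) =O[𝓝[>] 0] fun _ => (1 : ℝ) := by
    intro i
    refine Fin.lastCases ?_ (fun μ => ?_) i
    · simpa using hmt.isBigO_one ℝ
    · simpa using (hR.fst_isBigO μ).trans hsq1
  have hmm : ∀ (μ : Fin n) (j : Fin (n + 1)), (fun ε => (∫ w in R ε, splitCoord μ.castSucc w) *
      (∫ w in R ε, splitCoord j w) / ∫ _ in R ε, (1 : ℝ)) =O[𝓝[>] 0] fun ε => ε ^ 2 := by
    intro μ j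
    have h0 : (fun ε => ∫ w in R ε, splitCoord μ.castSucc w) =O[𝓝[>] 0] fun ε => ε ^ 2 := by
      simpa using hR.fst_isBigO μ
    simpa [div_eq_mul_inv] using (h0.mul (hm1 j)).mul hinv
  have hentry : ∀ i j, (fun ε => ε ^ (n + 3) * ((∫ w in R ε, splitCoord i w * splitCoord j w) -
      (∫ w in R ε, splitCoord i w) * (∫ w in R ε, splitCoord j w) / ∫ _ in R ε, (1 : ℝ)) -
        if i = j then approxEigenvalue κ ε i else 0) =O[𝓝[>] 0] fun ε => ε ^ (n + 5) := by
    have hscale : ∀ F : ℝ → ℝ, F =O[𝓝[>] 0] (fun ε => ε ^ 2) →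
        (fun ε => ε ^ (n + 3) * F ε) =O[𝓝[>] 0] fun ε => ε ^ (n + 5) := fun F hF => by
      simpa [← pow_add] using (isBigO_refl (fun ε : ℝ => ε ^ (n + 3)) (𝓝[>] 0)).mul hF
    intro i j
    refine Fin.lastCases ?_ (fun μ => ?_) i <;> refine Fin.lastCases ?_ (fun ν => ?_) j
    · refine (hscale _ (hR.snd_sq_isBigO.sub hquot)).congr' ?_ EventuallyEq.rfl
      filter_upwards [self_mem_nhdsWithin] with ε hε
      rw [if_pos rfl, approxEigenvalue_last κ hε]
      simp only [splitCoord_last, ← sq]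
      ring
    · refine (hscale _ ((hR.fst_mul_snd_isBigO ν).sub (hmm ν (Fin.last n)))).congr' ?_
        EventuallyEq.rfl
      filter_upwards with ε
      simp [(Fin.castSucc_lt_last ν).ne', mul_comm]
    · refine (hscale _ ((hR.fst_mul_snd_isBigO μ).sub (hmm μ (Fin.last n)))).congr' ?_
        EventuallyEq.rfl
      filter_upwards with ε
      simp [(Fin.castSucc_lt_last μ).ne]
    · refine (hscale _ ((hR.fst_mul_fst_isBigO μ ν).sub (hmm μ ν.castSucc))).congr' ?_
        EventuallyEq.rfl
      filter_upwards [self_mem_nhdsWithin] with ε hε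
      simp only [splitCoord_castSucc, Fin.castSucc_inj]
      by_cases h : μ = ν
      · subst h
        rw [if_pos rfl, if_pos rfl, if_pos rfl, approxEigenvalue_castSucc κ hε]
        ring
      · simp only [if_neg h]
        ring
  have hentry' : ∀ i j, (fun ε => inner ℝ (b i)
      (Matrix.toEuclideanLin (covarianceMatrix (sphericalComponent S N p ε)) (b j)) -
        if i = j then approxEigenvalue κ ε i else 0) =O[𝓝[>] 0] fun ε => ε ^ (n + 5) := by
    intro i j
    refine (hentry i j).congr' ?_ EventuallyEq.rfl
    filter_upwards [Ioo_mem_nhdsGT hr, hVt.eventually_ne (by positivity)] with ε hε hV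
    obtain ⟨hm, hsub, -⟩ := hdesc ε hε.1 hε.2
    rw [inner_covarianceMatrix_eq_rescaled b p hε.1 hm hsub hV]
  unfold diagonalDefect
  exact IsBigO.fun_sum fun i _ => IsBigO.fun_sum fun j _ => (hentry' i j).abs_left

/-! ### Convergence of the eigenvectors -/

/-- Convergence of eigenvectors: the rate is the ratio of the error to the spectral gap. -/
lemma distUpToSign_isBigO {m s t : ℕ} {T : ℝ → EuclideanSpace ℝ (Fin m) →ₗ[ℝ] EuclideanSpace ℝ (Fin m)}
    {b : OrthonormalBasis (Fin m) ℝ (EuclideanSpace ℝ (Fin m))} {d : ℝ → Fin m → ℝ} {i : Fin m}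
    (ht : t ≠ 0) {l : ℝ → ℝ}
    (hdef : (fun ε => diagonalDefect (T ε) b (d ε)) =O[𝓝[>] 0] fun ε => ε ^ (s + t))
    (hl : ∀ᶠ ε in 𝓝[>] (0 : ℝ), |l ε - d ε i| ≤ diagonalDefect (T ε) b (d ε))
    (hgap : ∀ k, k ≠ i → ∃ g > 0, ∀ᶠ ε in 𝓝[>] (0 : ℝ), g * ε ^ s ≤ |d ε i - d ε k|)
    {v : ℝ → EuclideanSpace ℝ (Fin m)}
    (hv : ∀ᶠ ε in 𝓝[>] (0 : ℝ), ‖v ε‖ = 1 ∧ T ε (v ε) = l ε • v ε) :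
    (fun ε => distUpToSign (v ε) (b i)) =O[𝓝[>] 0] fun ε => ε ^ t := by
  obtain ⟨C, hC0, hC⟩ := hdef.exists_pos
  rw [isBigOWith_iff] at hC
  -- a common lower bound for all the gaps
  obtain ⟨g, hg, hgap'⟩ : ∃ g > 0, ∀ᶠ ε in 𝓝[>] (0 : ℝ), ∀ k, k ≠ i →
      g * ε ^ s ≤ |d ε i - d ε k| := by
    have h1 : ∀ k, ∃ g > 0, k ≠ i → ∀ᶠ ε in 𝓝[>] (0 : ℝ), g * ε ^ s ≤ |d ε i - d ε k| := fun k => by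
      by_cases hk : k = i
      · exact ⟨1, one_pos, fun h => absurd hk h⟩
      · obtain ⟨g, hg, h⟩ := hgap k hk
        exact ⟨g, hg, fun _ => h⟩
    choose g hg h using h1
    have hne : (Finset.univ : Finset (Fin m)).Nonempty := ⟨i, Finset.mem_univ i⟩
    refine ⟨Finset.univ.inf' hne g, (Finset.lt_inf'_iff hne).2 fun k _ => hg k, ?_⟩
    rw [eventually_all]
    intro k
    by_cases hk : k = i
    · exact Eventually.of_forall fun ε h => absurd hk h
    · filter_upwards [h k hk, self_mem_nhdsWithin] with ε hε hpos _
      have hpos : 0 < ε := hpos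
      exact (mul_le_mul_of_nonneg_right (Finset.inf'_le _ (Finset.mem_univ k))
        (by positivity)).trans hε
  have hsmall : ∀ᶠ ε in 𝓝[>] (0 : ℝ), C * ε ^ t < g / 2 := by
    have : Tendsto (fun ε : ℝ => C * ε ^ t) (𝓝[>] 0) (𝓝 0) :=
      tendsto_nhdsWithin_of_tendsto_nhds (Continuous.tendsto' (by fun_prop) _ _ (by simp [ht]))
    exact this.eventually_lt_const (by positivity)
  refine IsBigO.of_bound (2 * m * (C / (g / 2))) ?_
  filter_upwards [hC, hl, hgap', hv, hsmall, self_mem_nhdsWithin] with ε h1 h2 h3 h4 h5 hε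
  have hε : 0 < ε := hε
  have hεs : 0 < ε ^ s := by positivity
  have hdef0 : diagonalDefect (T ε) b (d ε) ≤ C * ε ^ (s + t) := by
    rw [Real.norm_of_nonneg (r := ε ^ (s + t)) (by positivity)] at h1
    exact (le_abs_self _).trans h1
  have hcomp : ∀ k, k ≠ i → |inner ℝ (b k) (v ε)| ≤ C / (g / 2) * ε ^ t := by
    intro k hk
    have e1 := abs_inner_le_of_eigenvector (T ε) b (d ε) h4.1 h4.2 k
    have e2 : g / 2 * ε ^ s ≤ |l ε - d ε k| := by
      have e3 := h3 k hk
      have e4 : |d ε i - d ε k| ≤ |l ε - d ε i| + |l ε - d ε k| := by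
        rw [abs_sub_comm (l ε) (d ε i)]
        exact abs_sub_le _ _ _
      have e5 : C * ε ^ (s + t) ≤ g / 2 * ε ^ s := by
        rw [pow_add, mul_left_comm, mul_comm (ε ^ s)]
        exact mul_le_mul_of_nonneg_right h5.le hεs.le
      linarith
    have e6 : g / 2 * ε ^ s * |inner ℝ (b k) (v ε)| ≤ C * ε ^ (s + t) :=
      (mul_le_mul_of_nonneg_right e2 (abs_nonneg _)).trans (e1.trans hdef0)
    rw [div_mul_eq_mul_div, le_div_iff₀ (by positivity)]
    rw [pow_add] at e6
    have e7 : ε ^ s * (|inner ℝ (b k) (v ε)| * (g / 2)) ≤ ε ^ s * (C * ε ^ t) := by linarith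
    exact le_of_mul_le_mul_left e7 hεs
  have hd0 : 0 ≤ distUpToSign (v ε) (b i) := le_min (norm_nonneg _) (norm_nonneg _)
  rw [Real.norm_of_nonneg hd0, Real.norm_of_nonneg (by positivity)]
  refine (distUpToSign_le b h4.1 i (by positivity) hcomp).trans (le_of_eq (by ring))

end Main

theorem mainTheorem1 {n : ℕ} (S : Set (EuclideanSpace ℝ (Fin (n + 1))))
    (hS : IsSmoothHypersurface S)
    (p : EuclideanSpace ℝ (Fin (n + 1))) (hp : p ∈ S)
    (N : EuclideanSpace ℝ (Fin (n + 1)) → EuclideanSpace ℝ (Fin (n + 1)))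
    (hN : IsUnitNormalFieldAround S N p)
    (κ : Fin n → ℝ) (e : Fin n → EuclideanSpace ℝ (Fin (n + 1)))
    (he : IsPrincipalBasis S N p κ e)
    (H : ℝ) (hH : H = ∑ μ, κ μ) :
    -- an enumeration of the eigenvalues, with multiplicity, of the covariance matrices
    ∃ eig : ℝ → Fin (n + 1) → ℝ,
      (∀ ε : ℝ, 0 < ε →
        (covarianceMatrix (sphericalComponent S N p ε)).charpoly =
          ∏ i, (Polynomial.X - Polynomial.C (eig ε i))) ∧
      (∀ μ : Fin n,
        (fun ε : ℝ => eig ε μ.castSucc -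
          (ballVolume (n + 1) ε * (ε ^ 2 / (2 * ((n : ℝ) + 3))) -
            ballVolume n ε * (ε ^ 4 / (2 * ((n : ℝ) + 2) * ((n : ℝ) + 4))) * (2 * κ μ + H)))
          =O[𝓝[>] 0] fun ε : ℝ => ε ^ (n + 5)) ∧
      ((fun ε : ℝ => eig ε (Fin.last n) -
          (ballVolume (n + 1) ε * (ε ^ 2 / (2 * ((n : ℝ) + 3))) -
            2 * (ballVolume n ε ^ 2 / ballVolume (n + 1) ε) * (ε ^ 4 / ((n : ℝ) + 2) ^ 2) *
              (1 + ballVolume n ε / ballVolume (n + 1) ε * (ε ^ 2 / ((n : ℝ) + 2)) * H)))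
          =O[𝓝[>] 0] fun ε : ℝ => ε ^ (n + 5)) ∧
      -- convergence of the eigenvectors when the principal curvatures are distinct
      (Function.Injective κ →
        (∀ (μ : Fin n) (v : ℝ → EuclideanSpace ℝ (Fin (n + 1))),
          (∀ᶠ ε in 𝓝[>] (0 : ℝ), ‖v ε‖ = 1 ∧
            Matrix.toEuclideanLin (covarianceMatrix (sphericalComponent S N p ε)) (v ε) =
              eig ε μ.castSucc • v ε) →
          (fun ε : ℝ => distUpToSign (v ε) (e μ)) =O[𝓝[>] 0] fun ε : ℝ => ε) ∧
        (∀ v : ℝ → EuclideanSpace ℝ (Fin (n + 1)),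
          (∀ᶠ ε in 𝓝[>] (0 : ℝ), ‖v ε‖ = 1 ∧
            Matrix.toEuclideanLin (covarianceMatrix (sphericalComponent S N p ε)) (v ε) =
              eig ε (Fin.last n) • v ε) →
          (fun ε : ℝ => distUpToSign (v ε) (N p)) =O[𝓝[>] 0] fun ε : ℝ => ε ^ 2)) := by
  subst hH
  obtain ⟨b, hbe, hbN⟩ := exists_adapted_orthonormalBasis hp hN he
  have hdef := diagonalDefect_isBigO hS hp hN he b hbe hbN
  choose eig hchar hclose using fun ε : ℝ => exists_eigenvalue_labelling
    (covarianceMatrix (sphericalComponent S N p ε)) (covarianceMatrix_isHermitian _) b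
      (approxEigenvalue κ ε)
  have hlabel : ∀ i, (fun ε => eig ε i - approxEigenvalue κ ε i) =O[𝓝[>] 0]
      fun ε : ℝ => ε ^ (n + 5) := fun i =>
    (IsBigO.of_bound 1 (Eventually.of_forall fun ε => by
      rw [one_mul]
      exact (hclose ε i).trans (le_abs_self _))).trans hdef
  refine ⟨eig, fun ε _ => hchar ε, fun μ => ?_, ?_, fun hκ => ⟨fun μ v hv => ?_, fun v hv => ?_⟩⟩
  · simpa [approxEigenvalue] using hlabel μ.castSucc
  · simpa [approxEigenvalue] using hlabel (Fin.last n)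
  · rw [← hbe]
    have hgap : ∀ k, k ≠ μ.castSucc → ∃ g > 0, ∀ᶠ ε in 𝓝[>] (0 : ℝ),
        g * ε ^ (n + 4) ≤ |approxEigenvalue κ ε μ.castSucc - approxEigenvalue κ ε k| := by
      intro k
      refine Fin.lastCases (fun _ => ?_) (fun ν hν => ?_) k
      · obtain ⟨g, hg, h⟩ := exists_normal_gap κ μ
        refine ⟨g, hg, ?_⟩
        filter_upwards [h, Ioo_mem_nhdsGT one_pos] with ε hε h01
        refine le_trans ?_ (hε.trans (le_abs_self _))
        exact mul_le_mul_of_nonneg_left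
          (pow_le_pow_of_le_one h01.1.le h01.2.le (by omega)) hg.le
      · exact exists_tangential_gap κ fun h => hν (by rw [hκ h])
    simpa using distUpToSign_isBigO (s := n + 4) one_ne_zero hdef
      (Eventually.of_forall fun ε => hclose ε μ.castSucc) hgap hv
  · rw [← hbN]
    have hgap : ∀ k, k ≠ Fin.last n → ∃ g > 0, ∀ᶠ ε in 𝓝[>] (0 : ℝ),
        g * ε ^ (n + 3) ≤ |approxEigenvalue κ ε (Fin.last n) - approxEigenvalue κ ε k| := by
      intro k
      refine Fin.lastCases (fun h => absurd rfl h) (fun ν _ => ?_) k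
      obtain ⟨g, hg, h⟩ := exists_normal_gap κ ν
      refine ⟨g, hg, h.mono fun ε hε => ?_⟩
      rw [abs_sub_comm]
      exact hε.trans (le_abs_self _)
    exact distUpToSign_isBigO (s := n + 3) two_ne_zero hdef
      (Eventually.of_forall fun ε => hclose ε (Fin.last n)) hgap hv
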